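/- **Notation.** Let $n\ge 1$ and $1<p<\infty$. A weight in $\mathbb R^n$ is a function $\omega\in L^1_{\mathrm{loc}}(\mathbb R^n)$ with $\omega>0$ almost everywhere. It is an $A_p$ weight if there is $A>0$ such that, for every cube $Q\subset\mathbb R^n$ with sides parallel to the axes, $$\Big(\frac1{|Q|}\int_Q\omega\,dx\Big)\Big(\frac1{|Q|}\int_Q\omega^{-1/(p-1)}\,dx\Big)^{p-1}\le A,$$ and $[\omega]_{A_p}$ is the infimum of all such $A$. Let $\operatorname{dist}(x,\emptyset)=\infty$. For an open set $G\subset\mathbb R^n$, a function $R:G\to\mathbb R$ with $0\le R(x)\le\operatorname{dist}(x,\partial G)$ for all $x\in G$, and $f\in L^p(G)$ (real or complex valued), put $$M_R(f)(x)=\sup_{0\le r\le R(x)}\frac1{|B(x,r)|}\int_{B(x,r)}|f(y)|\,dy,\qquad x\in G,$$ where $B(x,r)$ is the open ball and the average for $r=0$ is understood as $|f(x)|$. **Theorem.** Let $n\ge 1$ and $1<p<\infty$. For every $A_p$ weight $\omega$ in $\mathbb R^n$ there is a constant $C>0$, depending only on $n$, $p$ and $[\omega]_{A_p}$, such that the following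 holds. Let $\emptyset\ne G\subset\mathbb R^n$ be open, let $0\le s\le 2$, and let $R:G\to\mathbb R$ be a measurable function with $0\le R(x)\le\operatorname{dist}(x,\partial G)$ for every $x\in G$. Then, for every $f\in L^p(G)$, the function $M_R(f)$ is finite almost everywhere in $G$ and $$\int_G\int_G\frac{|M_R(f)(x)-M_R(f)(y)|^p}{(|x-y|+|R(x)-R(y)|)^{sp}}\,\omega(x-y)\,dy\,dx\le C\int_G\int_G\frac{|f(x)-f(y)|^p}{|x-y|^{sp}}\,\omega(x-y)\,dy\,dx.$$ (The right-hand side may be infinite.) -/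

import Mathlib

open MeasureTheory
open scoped ENNReal

noncomputable section

namespace FracMaximal

/-- The closed cube in `ℝⁿ` with centre `c` and side length `2 * r`, sides parallel to the axes. -/
def cube {n : ℕ} (c : EuclideanSpace ℝ (Fin n)) (r : ℝ) : Set (EuclideanSpace ℝ (Fin n)) :=
  {y | ∀ i, |y i - c i| ≤ r}

/-- A weight in `ℝⁿ`: a locally integrable function that is positive almost everywhere. -/
def IsWeight {n : ℕ} (ω : EuclideanSpace ℝ (Fin n) → ℝ) : Prop :=
  LocallyIntegrable ω volume ∧ ∀ᵐ x, 0 < ω x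

/-- The `A_p` inequality with constant `A`, for every cube. The averages are taken in `[0, ∞]`, so
that the inequality contains the local integrability of `ω ^ (-1/(p-1))`. -/
def ApBound {n : ℕ} (p : ℝ) (ω : EuclideanSpace ℝ (Fin n) → ℝ) (A : ℝ) : Prop :=
  ∀ (c : EuclideanSpace ℝ (Fin n)) (r : ℝ), 0 < r →
    (⨍⁻ x in cube c r, ENNReal.ofReal (ω x) ∂volume) *
      (⨍⁻ x in cube c r, ENNReal.ofReal (ω x) ^ (-1 / (p - 1)) ∂volume) ^ (p - 1)
        ≤ ENNReal.ofReal A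

/-- `ω` is a Muckenhoupt `A_p` weight. -/
def IsApWeight {n : ℕ} (p : ℝ) (ω : EuclideanSpace ℝ (Fin n) → ℝ) : Prop :=
  IsWeight ω ∧ ∃ A : ℝ, 0 < A ∧ ApBound p ω A

/-- The `A_p` constant `[ω]_{A_p}`: the infimum of the admissible constants. -/
def apConst {n : ℕ} (p : ℝ) (ω : EuclideanSpace ℝ (Fin n) → ℝ) : ℝ :=
  sInf {A : ℝ | 0 < A ∧ ApBound p ω A}

/-- The average of `|f|` over the open ball `B(x, r)`, with value `|f x|` for `r = 0`. -/
def ballAverage {n : ℕ} {𝕜 : Type*} [RCLike 𝕜] (f : EuclideanSpace ℝ (Fin n) → 𝕜)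
    (x : EuclideanSpace ℝ (Fin n)) (r : ℝ) : ℝ≥0∞ :=
  if r = 0 then ‖f x‖ₑ else ⨍⁻ y in Metric.ball x r, ‖f y‖ₑ ∂volume

/-- The maximal function `M_R f (x)`, the supremum of the averages of `|f|` over the balls `B(x, r)`
with `0 ≤ r ≤ R x`, as an element of `[0, ∞]`. If `x ∈ G` and `R x ≤ dist(x, ∂G)`, these balls lie
in `G`, so the values of `f` outside `G` play no role. -/
def maximalFunction {n : ℕ} {𝕜 : Type*} [RCLike 𝕜] (R : EuclideanSpace ℝ (Fin n) → ℝ)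
    (f : EuclideanSpace ℝ (Fin n) → 𝕜) (x : EuclideanSpace ℝ (Fin n)) : ℝ≥0∞ :=
  ⨆ r ∈ Set.Icc (0 : ℝ) (R x), ballAverage f x r

/-- The `p`-th power of the fractional weighted Sobolev seminorm,
`∫_G ∫_G |u(x) - u(y)|^p / |x - y|^{sp} ω(x - y) dy dx`, with values in `[0, ∞]`.
On the diagonal the integrand is `0`. -/
def seminormPow {n : ℕ} {𝕜 : Type*} [RCLike 𝕜] (G : Set (EuclideanSpace ℝ (Fin n))) (s p : ℝ)
    (ω : EuclideanSpace ℝ (Fin n) → ℝ) (u : EuclideanSpace ℝ (Fin n) → 𝕜) : ℝ≥0∞ :=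
  ∫⁻ x in G, ∫⁻ y in G,
    ‖u x - u y‖ₑ ^ p / ENNReal.ofReal ‖x - y‖ ^ (s * p) * ENNReal.ofReal (ω (x - y))

/-- The `p`-th power of the `R`-modified fractional weighted Sobolev seminorm,
`∫_G ∫_G |u(x) - u(y)|^p / (|x - y| + |R(x) - R(y)|)^{sp} ω(x - y) dy dx`,
with values in `[0, ∞]`. -/
def modifiedSeminormPow {n : ℕ} {𝕜 : Type*} [RCLike 𝕜] (G : Set (EuclideanSpace ℝ (Fin n)))
    (R : EuclideanSpace ℝ (Fin n) → ℝ) (s p : ℝ)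
    (ω : EuclideanSpace ℝ (Fin n) → ℝ) (u : EuclideanSpace ℝ (Fin n) → 𝕜) : ℝ≥0∞ :=
  ∫⁻ x in G, ∫⁻ y in G,
    ‖u x - u y‖ₑ ^ p / ENNReal.ofReal (‖x - y‖ + |R x - R y|) ^ (s * p) *
      ENNReal.ofReal (ω (x - y))

end FracMaximal

end

noncomputable section

/-! Put `d = |x - y| + |R x - R y|` and let `S(a, b) = |f(a) - f(b)| / |a - b|^s` on `G × G`, zero
elsewhere. A radius `r` admissible at `x` with `r > d` is compared with `r - d`, which is admissible
at `y`; a radius `r ≤ d` is compared with the radius `0` at `y`.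

In the main case `x + r z` is coupled with `y + (r - d) z`, where `z` is uniform in the unit ball.
The two points are at distance at most `2d`, so the loss is `(2d)^s` times a value of `S`; but their
difference varies with `z`, and no diagonal average of `S` controls that. An auxiliary point,
averaged over `B(x + (r - d) z, d)`, cures this: the loss becomes a maximal function of `S` in one
variable, taken at pairs whose difference is exactly `x - y`. Averaging in `z` then yields a maximal
function along the diagonal. The result (`maximalFunction_le_add_majorant`) is `M f(x) ≤ M f(y) +
(2d)^s T(x, y)`, with `T = majorant S`, and the modified denominator absorbs `d^s`.

It remains to bound `T` by `S` in `L^p` with weight `ω(x - y)`. With one variable frozen, the weight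
is a translate or reflection of `ω`, so Muckenhoupt's theorem applies
(`BallAp.lintegral_ballMax_rpow_mul_le`, by Lerner's argument). Along the diagonal the weight is
constant and the unweighted theorem suffices (`weightedEnergy_maxDiag_le`). -/

namespace FracMaximal

open Set Metric

/-! ### Countable uncentred maximal function and its weak-type bound. -/

section BallMax

variable {X : Type*} [MetricSpace X] [TopologicalSpace.SeparableSpace X] [Nonempty X]
  [MeasurableSpace X]

/-- The balls with centre in a countable dense set and positive rational radius. -/
def ratBall (X : Type*) [MetricSpace X] [TopologicalSpace.SeparableSpace X] [Nonempty X]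
    (i : ℕ × {q : ℚ // 0 < q}) : Set X :=
  ball (TopologicalSpace.denseSeq X i.1) (i.2.1 : ℝ)

/-- The uncentred maximal function with respect to the measure `ν`, over the countable family
`ratBall X`. -/
def ballMax (ν : Measure X) (h : X → ℝ≥0∞) (x : X) : ℝ≥0∞ :=
  ⨆ i, (ratBall X i).indicator (fun _ => ⨍⁻ y in ratBall X i, h y ∂ν) x

lemma lt_ballMax_iff {ν : Measure X} {h : X → ℝ≥0∞} {x : X} {t : ℝ≥0∞} :
    t < ballMax ν h x ↔ ∃ i, x ∈ ratBall X i ∧ t < ⨍⁻ y in ratBall X i, h y ∂ν := by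
  rw [ballMax, lt_iSup_iff]
  refine exists_congr fun i => ?_
  by_cases hx : x ∈ ratBall X i <;> simp [hx]

lemma laverage_le_ballMax (ν : Measure X) (h : X → ℝ≥0∞) {x : X} {i}
    (hx : x ∈ ratBall X i) : ⨍⁻ y in ratBall X i, h y ∂ν ≤ ballMax ν h x := by
  refine le_trans ?_ (le_iSup _ i)
  simp [hx]

/-- A countable supremum of multiples of indicators of open balls is measurable whatever `h` is;
this is the reason for using only countably many balls. -/
lemma measurable_ballMax [OpensMeasurableSpace X] (ν : Measure X) (h : X → ℝ≥0∞) :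
    Measurable (ballMax ν h) :=
  Measurable.iSup fun _ => measurable_const.indicator isOpen_ball.measurableSet

lemma measurable_ballMax_prod [OpensMeasurableSpace X] {Y : Type*} [MeasurableSpace Y]
    (ν : Measure X) [SFinite ν] {F : X → Y → ℝ≥0∞} (hF : Measurable (Function.uncurry F)) :
    Measurable fun q : X × Y => ballMax ν (fun z => F z q.2) q.1 := by
  refine Measurable.iSup fun i => ?_
  have h1 : Measurable fun q : X × Y => ⨍⁻ z in ratBall X i, F z q.2 ∂ν := by
    simp only [setLAverage_eq]
    refine Measurable.div_const ?_ _
    have : Measurable fun y => ∫⁻ z in ratBall X i, F z y ∂ν :=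
      Measurable.lintegral_prod_left' (f := fun q : X × Y => F q.1 q.2) hF
    exact this.comp measurable_snd
  have h2 : MeasurableSet {q : X × Y | q.1 ∈ ratBall X i} :=
    measurable_fst isOpen_ball.measurableSet
  convert h1.indicator h2 using 2 with q
  simp [Set.indicator]

lemma ballMax_add_le [OpensMeasurableSpace X] (ν : Measure X) {g h : X → ℝ≥0∞}
    (hg : Measurable g) (c : ℝ≥0∞) (hh : ∀ y, h y ≤ g y + c) (x : X) :
    ballMax ν h x ≤ ballMax ν g x + c := by
  refine iSup_le fun i => ?_
  by_cases hx : x ∈ ratBall X i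
  · rw [indicator_of_mem hx]
    calc ⨍⁻ y in ratBall X i, h y ∂ν ≤ ⨍⁻ y in ratBall X i, (g y + c) ∂ν := by
          rw [setLAverage_eq, setLAverage_eq]; gcongr; exact hh _
      _ = ⨍⁻ y in ratBall X i, g y ∂ν + c * ν (ratBall X i) / ν (ratBall X i) := by
          rw [setLAverage_eq, setLAverage_eq, lintegral_add_left hg, setLIntegral_const,
            ENNReal.add_div]
      _ ≤ ballMax ν g x + c := by
          gcongr
          · exact laverage_le_ballMax ν g hx
          -- Only `≤` is claimed, which also covers balls of measure zero or infinity.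
          · exact ENNReal.div_le_of_le_mul le_rfl
  · simp [hx]

/-- Weak type (1,1): Vitali's covering lemma extracts disjoint balls with large averages, whose
enlargements cover the level set; doubling pays for the enlargement. -/
lemma mul_measure_lt_ballMax_le [OpensMeasurableSpace X] {ν : Measure X} {D : ℝ≥0∞}
    (hD : ∀ (c : X) (r : ℝ), 0 < r → ν (ball c (6 * r)) ≤ D * ν (ball c r))
    (h : X → ℝ≥0∞) (t : ℝ≥0∞) :
    t * ν {x | t < ballMax ν h x} ≤ D * ∫⁻ x, h x ∂ν := by
  let c : ℕ × {q : ℚ // 0 < q} → X := fun i => TopologicalSpace.denseSeq X i.1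
  let r : ℕ × {q : ℚ // 0 < q} → ℝ := fun i => (i.2.1 : ℝ)
  have hr : ∀ i, 0 < r i := fun i => by simpa [r] using i.2.2
  -- Vitali's lemma needs bounded radii, so the level set is exhausted by the parts seen by balls of
  -- radius at most `N`.
  let A : ℕ → Set X := fun N =>
    {x | ∃ i, r i ≤ N ∧ x ∈ ball (c i) (r i) ∧ t < ⨍⁻ y in ball (c i) (r i), h y ∂ν}
  have hA : {x | t < ballMax ν h x} = ⋃ N, A N := by
    ext x
    simp only [mem_ofPred_eq, lt_ballMax_iff, mem_iUnion, A]
    constructor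
    · rintro ⟨i, hi⟩
      obtain ⟨N, hN⟩ := exists_nat_ge (r i)
      exact ⟨N, i, hN, hi⟩
    · rintro ⟨N, i, -, hi⟩
      exact ⟨i, hi⟩
  have hmono : Monotone A := by
    rintro N N' hN x ⟨i, hi, h⟩
    exact ⟨i, hi.trans (by exact_mod_cast hN), h⟩
  rw [hA, hmono.measure_iUnion, ENNReal.mul_iSup]
  refine iSup_le fun N => ?_
  -- The enlargement factor is 5 for closed balls; 6 makes room for open ones.
  obtain ⟨u, hut, hdisj, hcov⟩ := Vitali.exists_disjoint_subfamily_covering_enlargement_closedBall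
    {i | r i ≤ N ∧ t < ⨍⁻ y in ball (c i) (r i), h y ∂ν} c r N (fun i hi => hi.1) 5 (by norm_num)
  have hdisj' : u.PairwiseDisjoint fun i => ball (c i) (r i) :=
    hdisj.mono fun i => ball_subset_closedBall
  have hu : u.Countable := to_countable u
  have hsub : A N ⊆ ⋃ i ∈ u, ball (c i) (6 * r i) := by
    rintro x ⟨i, hi, hx, hlt⟩
    obtain ⟨j, hj, hij⟩ := hcov i ⟨hi, hlt⟩
    refine mem_biUnion hj (closedBall_subset_ball ?_ (hij (ball_subset_closedBall hx)))
    linarith [hr j]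
  calc t * ν (A N) ≤ t * ∑' i : u, D * ν (ball (c i) (r i)) := by
        gcongr
        exact (measure_mono hsub).trans ((measure_biUnion_le ν hu _).trans
          (ENNReal.tsum_le_tsum fun i => hD _ _ (hr i)))
    _ = D * ∑' i : u, t * ν (ball (c i) (r i)) := by
        rw [ENNReal.tsum_mul_left, ENNReal.tsum_mul_left]; ring
    _ ≤ D * ∑' i : u, ∫⁻ x in ball (c i) (r i), h x ∂ν := by
        gcongr with i
        have := (hut i.2).2
        rw [setLAverage_eq] at this
        exact (ENNReal.mul_lt_of_lt_div this).le
    _ = D * ∫⁻ x in ⋃ i ∈ u, ball (c i) (r i), h x ∂ν := by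
        rw [lintegral_biUnion hu (fun i _ => isOpen_ball.measurableSet) hdisj']
    _ ≤ D * ∫⁻ x, h x ∂ν := by gcongr; exact Measure.restrict_le_self

end BallMax

/-! ### From weak type to `L^q` for doubling measures. -/

/-- The layer-cake formula for one number in `[0, ∞]`. -/
lemma lintegral_Ioi_indicator_rpow {q : ℝ} (hq : 0 < q) (a : ℝ≥0∞) :
    ∫⁻ t in Ioi (0 : ℝ), {t : ℝ | ENNReal.ofReal t < a}.indicator
      (fun t => ENNReal.ofReal (t ^ (q - 1))) t = a ^ q / ENNReal.ofReal q := by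
  have key : ∀ b : ℝ, 0 ≤ b → ∫⁻ t in Ioi (0 : ℝ), {t : ℝ | ENNReal.ofReal t <
      ENNReal.ofReal b}.indicator (fun t => ENNReal.ofReal (t ^ (q - 1))) t
        = ENNReal.ofReal b ^ q / ENNReal.ofReal q := by
    intro b hb
    have hm : MeasurableSet {t : ℝ | ENNReal.ofReal t < ENNReal.ofReal b} :=
      ENNReal.measurable_ofReal measurableSet_Iio
    rw [lintegral_indicator hm, Measure.restrict_restrict hm]
    have hs : {t : ℝ | ENNReal.ofReal t < ENNReal.ofReal b} ∩ Ioi 0 = Ioo 0 b := by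
      ext t
      simp only [mem_inter_iff, mem_ofPred_eq, mem_Ioi, mem_Ioo]
      constructor
      · rintro ⟨h1, h2⟩
        exact ⟨h2, (ENNReal.ofReal_lt_ofReal_iff_of_nonneg h2.le).1 h1⟩
      · rintro ⟨h1, h2⟩
        exact ⟨(ENNReal.ofReal_lt_ofReal_iff_of_nonneg h1.le).2 h2, h1⟩
    have hi : IntervalIntegrable (fun t : ℝ => t ^ (q - 1)) volume 0 b :=
      intervalIntegral.intervalIntegrable_rpow' (by linarith)
    rw [hs, setLIntegral_congr Ioo_ae_eq_Ioc, ← ofReal_integral_eq_lintegral_ofReal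
      ((intervalIntegrable_iff_integrableOn_Ioc_of_le hb).1 hi)
      ((ae_restrict_iff' measurableSet_Ioc).2 (Filter.Eventually.of_forall fun t ht =>
        Real.rpow_nonneg ht.1.le _)), ← intervalIntegral.integral_of_le hb,
      integral_rpow (Or.inl (by linarith)), sub_add_cancel, Real.zero_rpow hq.ne', sub_zero,
      ENNReal.ofReal_div_of_pos hq, ENNReal.ofReal_rpow_of_nonneg hb hq.le]
  rcases eq_or_ne a ∞ with rfl | ha
  · rw [ENNReal.top_rpow_of_pos hq, ENNReal.top_div_of_ne_top ENNReal.ofReal_ne_top]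
    refine ENNReal.eq_top_of_forall_nnreal_le fun M => ?_
    -- This cut-off is chosen so that the truncated integral equals `M`.
    have h2 := key ((q * M) ^ (q⁻¹)) (by positivity)
    have h3 : ENNReal.ofReal ((q * M) ^ (q⁻¹)) ^ q / ENNReal.ofReal q = M := by
      rw [ENNReal.ofReal_rpow_of_nonneg (by positivity) hq.le, ← ENNReal.ofReal_div_of_pos hq,
        Real.rpow_inv_rpow (by positivity) hq.ne', mul_div_cancel_left₀ _ hq.ne',
        ENNReal.ofReal_coe_nnreal]
    rw [← h3, ← h2]
    refine lintegral_mono fun t => ?_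
    exact indicator_le_indicator_of_subset (fun t ht => lt_of_lt_of_le (b := ENNReal.ofReal ((q * M) ^ (q⁻¹))) ht le_top)
      (fun _ => zero_le) t
  · simpa [ENNReal.ofReal_toReal ha] using key a.toReal ENNReal.toReal_nonneg

section Strong

variable {X : Type*} [MetricSpace X] [TopologicalSpace.SeparableSpace X] [Nonempty X]
  [MeasurableSpace X] [OpensMeasurableSpace X]

/-- The constant of the Hardy–Littlewood inequality in `L^q` for doubling constant `D`. -/
def strongConst (q : ℝ) (D : ℝ≥0∞) : ℝ≥0∞ :=
  ENNReal.ofReal q * (2 * D * (2 ^ (q - 1) / ENNReal.ofReal (q - 1)))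

lemma strongConst_ne_top {q : ℝ} (hq : 1 < q) {D : ℝ≥0∞} (hD : D ≠ ∞) : strongConst q D ≠ ∞ := by
  have h1 : ENNReal.ofReal (q - 1) ≠ 0 := by simpa using hq
  have h2 : (2 : ℝ≥0∞) ^ (q - 1) ≠ ∞ := ENNReal.rpow_ne_top_of_nonneg (by linarith) (by simp)
  exact ENNReal.mul_ne_top ENNReal.ofReal_ne_top
    (ENNReal.mul_ne_top (ENNReal.mul_ne_top (by simp) hD) (ENNReal.div_ne_top h2 h1))

/-- The Hardy–Littlewood maximal inequality in `L^q` for a doubling measure. -/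
lemma lintegral_ballMax_rpow_le {ν : Measure X} [SFinite ν] {D : ℝ≥0∞}
    (hD : ∀ (c : X) (r : ℝ), 0 < r → ν (ball c (6 * r)) ≤ D * ν (ball c r))
    {q : ℝ} (hq : 1 < q) {h : X → ℝ≥0∞} (hh : Measurable h) :
    ∫⁻ x, ballMax ν h x ^ q ∂ν ≤ strongConst q D * ∫⁻ x, h x ^ q ∂ν := by
  have hq0 : 0 < q := by linarith
  have hq1 : 0 < q - 1 := by linarith
  have hqq : ENNReal.ofReal q ≠ 0 := by simpa using hq0
  have weak : ∀ t : ℝ, 0 < t → ν {x | ENNReal.ofReal t < ballMax ν h x} ≤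
      2 * D * (ENNReal.ofReal t)⁻¹ * ∫⁻ x, {x | ENNReal.ofReal t < 2 * h x}.indicator h x ∂ν := by
    intro t ht
    have ht0 : ENNReal.ofReal t ≠ 0 := by simpa using ht
    -- Off `E` one has `h ≤ t / 2`, which contributes at most `t / 2` to the maximal function; only
    -- the part of `h` on `E` enters the weak bound. This is Marcinkiewicz interpolation with the
    -- trivial `L^∞` bound.
    set E : Set X := {x | ENNReal.ofReal t < 2 * h x} with hE
    have hEm : MeasurableSet E := (hh.const_mul 2) measurableSet_Ioi
    have hsub : {x | ENNReal.ofReal t < ballMax ν h x} ⊆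
        {x | ENNReal.ofReal t / 2 < ballMax ν (E.indicator h) x} := by
      intro x hx
      have h1 := ballMax_add_le ν (hh.indicator hEm) (ENNReal.ofReal t / 2) (h := h) (fun y => by
        by_cases hy : y ∈ E
        · simp [hy]
        · have : 2 * h y ≤ ENNReal.ofReal t := not_lt.1 hy
          rw [indicator_of_notMem hy, zero_add]
          rw [ENNReal.le_div_iff_mul_le (by simp) (by simp), mul_comm]
          exact this) x
      have h2 : ENNReal.ofReal t / 2 + ENNReal.ofReal t / 2 <
          ballMax ν (E.indicator h) x + ENNReal.ofReal t / 2 := by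
        rw [ENNReal.add_halves]; exact lt_of_lt_of_le hx h1
      exact lt_of_add_lt_add_right h2
    have h3 := mul_measure_lt_ballMax_le hD (E.indicator h) (ENNReal.ofReal t / 2)
    calc ν {x | ENNReal.ofReal t < ballMax ν h x}
        ≤ ν {x | ENNReal.ofReal t / 2 < ballMax ν (E.indicator h) x} := measure_mono hsub
      _ = 2 * (ENNReal.ofReal t)⁻¹ * (ENNReal.ofReal t / 2 *
            ν {x | ENNReal.ofReal t / 2 < ballMax ν (E.indicator h) x}) := by
          rw [← mul_assoc, ENNReal.div_eq_inv_mul, mul_mul_mul_comm,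
            ENNReal.mul_inv_cancel two_ne_zero (by simp),
            ENNReal.inv_mul_cancel ht0 ENNReal.ofReal_ne_top, one_mul, one_mul]
      _ ≤ 2 * (ENNReal.ofReal t)⁻¹ * (D * ∫⁻ x, E.indicator h x ∂ν) := by gcongr
      _ = _ := by ring
  have hM := measurable_ballMax ν h
  have hmeas1 : Measurable fun z : X × ℝ => {t : ℝ | ENNReal.ofReal t < ballMax ν h z.1}.indicator
      (fun t => ENNReal.ofReal (t ^ (q - 1))) z.2 := by
    have : MeasurableSet {z : X × ℝ | ENNReal.ofReal z.2 < ballMax ν h z.1} :=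
      measurableSet_lt (by fun_prop) (hM.comp measurable_fst)
    exact (Measurable.indicator (f := fun z : X × ℝ => ENNReal.ofReal (z.2 ^ (q - 1)))
      (by fun_prop) this)
  have hset : MeasurableSet {z : X × ℝ | ENNReal.ofReal z.2 < 2 * h z.1} :=
      measurableSet_lt (by fun_prop) ((hh.comp measurable_fst).const_mul 2)
  have hmeas2 : Measurable fun z : X × ℝ => {t : ℝ | ENNReal.ofReal t < 2 * h z.1}.indicator
      (fun t => ENNReal.ofReal (t ^ (q - 1 - 1))) z.2 :=
    (Measurable.indicator (f := fun z : X × ℝ => ENNReal.ofReal (z.2 ^ (q - 1 - 1)))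
      (by fun_prop) hset)
  calc ∫⁻ x, ballMax ν h x ^ q ∂ν
      = ENNReal.ofReal q * ∫⁻ x, (∫⁻ t in Ioi (0 : ℝ),
          {t : ℝ | ENNReal.ofReal t < ballMax ν h x}.indicator
            (fun t => ENNReal.ofReal (t ^ (q - 1))) t) ∂ν := by
        rw [← lintegral_const_mul' _ _ ENNReal.ofReal_ne_top]
        refine lintegral_congr fun x => ?_
        rw [lintegral_Ioi_indicator_rpow hq0, ENNReal.mul_div_cancel hqq ENNReal.ofReal_ne_top]
    _ = ENNReal.ofReal q * ∫⁻ t in Ioi (0 : ℝ), ENNReal.ofReal (t ^ (q - 1)) *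
          ν {x | ENNReal.ofReal t < ballMax ν h x} := by
        rw [lintegral_lintegral_swap hmeas1.aemeasurable]
        congr 1
        refine lintegral_congr fun t => ?_
        rw [← setLIntegral_const, ← lintegral_indicator (s := {x | ENNReal.ofReal t < ballMax ν h x})
          (hM measurableSet_Ioi)]
        rfl
    _ ≤ ENNReal.ofReal q * ∫⁻ t in Ioi (0 : ℝ), 2 * D * ∫⁻ x, h x *
          {t : ℝ | ENNReal.ofReal t < 2 * h x}.indicator
            (fun t => ENNReal.ofReal (t ^ (q - 1 - 1))) t ∂ν := by
        gcongr ENNReal.ofReal q * ?_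
        refine setLIntegral_mono' measurableSet_Ioi fun t ht => ?_
        have ht' : 0 < t := ht
        have e1 : ENNReal.ofReal (t ^ (q - 1)) * (ENNReal.ofReal t)⁻¹ =
            ENNReal.ofReal (t ^ (q - 1 - 1)) := by
          rw [← ENNReal.ofReal_inv_of_pos ht', ← ENNReal.ofReal_mul (by positivity),
            Real.rpow_sub_one ht'.ne' (q - 1), div_eq_mul_inv]
        calc ENNReal.ofReal (t ^ (q - 1)) * ν {x | ENNReal.ofReal t < ballMax ν h x}
            ≤ ENNReal.ofReal (t ^ (q - 1)) * (2 * D * (ENNReal.ofReal t)⁻¹ *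
                ∫⁻ x, {x | ENNReal.ofReal t < 2 * h x}.indicator h x ∂ν) := by
              gcongr; exact weak t ht'
          _ = 2 * D * (ENNReal.ofReal (t ^ (q - 1 - 1)) *
                ∫⁻ x, {x | ENNReal.ofReal t < 2 * h x}.indicator h x ∂ν) := by
              rw [← e1]; ring
          _ = _ := by
              rw [← lintegral_const_mul' _ _ ENNReal.ofReal_ne_top]
              congr 1
              refine lintegral_congr fun x => ?_
              by_cases hx : ENNReal.ofReal t < 2 * h x
              · simp [indicator, hx, mul_comm (h x)]
              · simp [indicator, hx]
    _ = ENNReal.ofReal q * (∫⁻ x, 2 * D * (h x * ∫⁻ t in Ioi (0 : ℝ),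
          {t : ℝ | ENNReal.ofReal t < 2 * h x}.indicator
            (fun t => ENNReal.ofReal (t ^ (q - 1 - 1))) t) ∂ν) := by
        have hm3 : Measurable fun z : X × ℝ => h z.1 *
          {t : ℝ | ENNReal.ofReal t < 2 * h z.1}.indicator
            (fun t => ENNReal.ofReal (t ^ (q - 1 - 1))) z.2 :=
          (hh.comp measurable_fst).mul hmeas2
        congr 1
        rw [lintegral_const_mul _ (hm3.lintegral_prod_left'), ← lintegral_lintegral_swap
          (f := fun x t => h x * {t : ℝ | ENNReal.ofReal t < 2 * h x}.indicator
            (fun t => ENNReal.ofReal (t ^ (q - 1 - 1))) t) hm3.aemeasurable,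
          ← lintegral_const_mul _ (hm3.lintegral_prod_right')]
        refine lintegral_congr fun x => ?_
        exact congrArg _ (lintegral_const_mul (h x) (hmeas2.comp measurable_prodMk_left))
    _ = _ := by
        rw [strongConst, mul_assoc, ← lintegral_const_mul _ (hh.pow_const q)]
        congr 1
        refine lintegral_congr fun x => ?_
        rw [lintegral_Ioi_indicator_rpow hq1, ENNReal.mul_rpow_of_nonneg _ _ hq1.le]
        have : h x ^ q = h x * h x ^ (q - 1) := by
          conv_lhs => rw [show q = 1 + (q - 1) by ring,
            ENNReal.rpow_add_of_nonneg _ _ zero_le_one hq1.le, ENNReal.rpow_one]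
        rw [this, div_eq_mul_inv, div_eq_mul_inv]
        ring

end Strong

/-! ### Doubling and Muckenhoupt's theorem for `A_p` weights. -/

section Muckenhoupt

set_option linter.unusedSectionVars false

variable {E : Type*} [NormedAddCommGroup E] [NormedSpace ℝ E] [FiniteDimensional ℝ E]
  [MeasureSpace E] [BorelSpace E] [(volume : Measure E).IsAddHaarMeasure]

/-- The `A_p` condition over balls, with constant `A`, for a `[0, ∞]`-valued weight. -/
structure BallAp (p : ℝ) (A : ℝ≥0∞) (w : E → ℝ≥0∞) : Prop where
  measurable : Measurable w
  ae_ne_zero : ∀ᵐ x, w x ≠ 0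
  ae_ne_top : ∀ᵐ x, w x ≠ ∞
  lintegral_ne_top : ∀ (c : E) (r : ℝ), ∫⁻ x in ball c r, w x ≠ ∞
  bound : ∀ (c : E) (r : ℝ), 0 < r →
    (∫⁻ x in ball c r, w x) * (∫⁻ x in ball c r, w x ^ (-1 / (p - 1))) ^ (p - 1) ≤
      A * volume (ball c r) ^ p

lemma volume_ball_mul (c : E) (r : ℝ) {k : ℝ} (hk : 0 < k) :
    volume (ball c (k * r)) = ENNReal.ofReal (k ^ Module.finrank ℝ E) * volume (ball c r) := by
  rw [Measure.addHaar_ball_mul_of_pos volume c hk, Measure.addHaar_ball_center volume c r]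

lemma volume_ball_ne_zero (c : E) {r : ℝ} (hr : 0 < r) : volume (ball c r) ≠ 0 :=
  (measure_ball_pos volume c hr).ne'

lemma volume_ball_ne_top (c : E) (r : ℝ) : volume (ball c r) ≠ ∞ :=
  measure_ball_lt_top.ne

variable {p : ℝ} {A : ℝ≥0∞} {w : E → ℝ≥0∞}

lemma BallAp.comp (hw : BallAp p A w) (T : E ≃ᵢ E) (hT : MeasurePreserving T volume volume) :
    BallAp p A (w ∘ T) := by
  have key : ∀ (f : E → ℝ≥0∞) (c : E) (r : ℝ),
      ∫⁻ x in ball c r, f (T x) = ∫⁻ x in ball (T c) r, f x := by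
    intro f c r
    have := hT.setLIntegral_comp_emb T.toHomeomorph.measurableEmbedding f (ball c r)
    rw [T.image_ball] at this
    exact this
  refine ⟨hw.measurable.comp hT.measurable, hT.quasiMeasurePreserving.ae hw.ae_ne_zero,
    hT.quasiMeasurePreserving.ae hw.ae_ne_top, fun c r => ?_, fun c r hr => ?_⟩
  · exact (key w c r).trans_ne (hw.lintegral_ne_top _ _)
  · have h1 := hw.bound (T c) r hr
    have h2 : volume (ball (T c) r) = volume (ball c r) := by
      rw [Measure.addHaar_ball_center, Measure.addHaar_ball_center volume c]
    rw [← key w c r, ← key (fun x => w x ^ (-1 / (p - 1))) c r, h2] at h1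
    exact h1

/-- Hölder's inequality for `1 = w^(1/p) * w^(-1/p)`. It reverses the `A_p` inequality, and the two
together give doubling. -/
lemma rpow_measure_le_mul_rpow (hp : 1 < p) (hm : Measurable w) (h0 : ∀ᵐ x, w x ≠ 0)
    (ht : ∀ᵐ x, w x ≠ ∞) (s : Set E) :
    volume s ^ p ≤ (∫⁻ x in s, w x) * (∫⁻ x in s, w x ^ (-1 / (p - 1))) ^ (p - 1) := by
  have hp0 : 0 < p := by linarith
  have hp1 : 0 < p - 1 := by linarith
  have hpq : p.HolderConjugate (p / (p - 1)) := Real.HolderConjugate.conjExponent hp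
  have h := ENNReal.lintegral_mul_le_Lp_mul_Lq (volume.restrict s) hpq
    (f := fun x => w x ^ (1 / p)) (g := fun x => w x ^ (-1 / p))
    (hm.pow_const _).aemeasurable (hm.pow_const _).aemeasurable
  have e1 : ∫⁻ x in s, ((fun x => w x ^ (1 / p)) * fun x => w x ^ (-1 / p)) x = volume s := by
    rw [← setLIntegral_one]
    refine lintegral_congr_ae ?_
    filter_upwards [ae_restrict_of_ae h0, ae_restrict_of_ae ht] with x hx0 hxt
    simp only [Pi.mul_apply]
    rw [← ENNReal.rpow_add _ _ hx0 hxt, show 1 / p + -1 / p = 0 by ring, ENNReal.rpow_zero]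
  have e2 : ∀ x, (w x ^ (1 / p)) ^ p = w x := fun x => by
    rw [← ENNReal.rpow_mul, one_div_mul_cancel hp0.ne', ENNReal.rpow_one]
  have e3 : ∀ x, (w x ^ (-1 / p)) ^ (p / (p - 1)) = w x ^ (-1 / (p - 1)) := fun x => by
    rw [← ENNReal.rpow_mul]; congr 1; field_simp
  rw [e1] at h
  simp only [e2, e3] at h
  calc volume s ^ p ≤ ((∫⁻ x in s, w x) ^ (1 / p) *
        (∫⁻ x in s, w x ^ (-1 / (p - 1))) ^ (1 / (p / (p - 1)))) ^ p := by gcongr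
    _ = _ := by
      rw [ENNReal.mul_rpow_of_nonneg _ _ hp0.le, ← ENNReal.rpow_mul, ← ENNReal.rpow_mul,
        one_div_mul_cancel hp0.ne', ENNReal.rpow_one]
      congr 2
      field_simp

lemma BallAp.lintegral_ne_zero (hw : BallAp p A w)
    (c : E) {r : ℝ} (hr : 0 < r) : ∫⁻ x in ball c r, w x ≠ 0 := by
  intro h
  rw [lintegral_eq_zero_iff hw.measurable] at h
  have : (volume.restrict (ball c r)) = 0 := by
    rw [← ae_eq_bot, ← Filter.eventually_false_iff_eq_bot]
    filter_upwards [h, ae_restrict_of_ae hw.ae_ne_zero] with x h1 h2 using h2 h1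
  rw [Measure.restrict_eq_zero] at this
  exact volume_ball_ne_zero c hr this

lemma BallAp.ae_dual_ne_zero (hw : BallAp p A w) : ∀ᵐ x, w x ^ (-1 / (p - 1)) ≠ 0 := by
  filter_upwards [hw.ae_ne_zero, hw.ae_ne_top] with x h1 h2
  exact (ENNReal.rpow_pos (pos_iff_ne_zero.2 h1) h2).ne'

lemma BallAp.ae_dual_ne_top (hw : BallAp p A w) : ∀ᵐ x, w x ^ (-1 / (p - 1)) ≠ ∞ := by
  filter_upwards [hw.ae_ne_zero, hw.ae_ne_top] with x h1 h2
  exact ENNReal.rpow_ne_top_of_ne_zero h1 h2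

lemma BallAp.dual_lintegral_ne_zero (hw : BallAp p A w)
    (c : E) {r : ℝ} (hr : 0 < r) :
    ∫⁻ x in ball c r, w x ^ (-1 / (p - 1)) ≠ 0 := by
  intro h
  rw [lintegral_eq_zero_iff (hw.measurable.pow_const _)] at h
  have : (volume.restrict (ball c r)) = 0 := by
    rw [← ae_eq_bot, ← Filter.eventually_false_iff_eq_bot]
    filter_upwards [h, ae_restrict_of_ae (hw.ae_dual_ne_zero)] with x h1 h2 using h2 h1
  rw [Measure.restrict_eq_zero] at this
  exact volume_ball_ne_zero c hr this

lemma BallAp.dual_lintegral_ne_top (hw : BallAp p A w) (hp : 1 < p) (hA : A ≠ ∞)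
    (c : E) {r : ℝ} (hr : 0 < r) :
    ∫⁻ x in ball c r, w x ^ (-1 / (p - 1)) ≠ ∞ := by
  intro h
  have h1 := hw.bound c r hr
  rw [h, ENNReal.top_rpow_of_pos (by linarith), ENNReal.mul_top (hw.lintegral_ne_zero c hr),
    top_le_iff] at h1
  exact ENNReal.mul_ne_top hA (ENNReal.rpow_ne_top_of_nonneg (by linarith)
    (volume_ball_ne_top c r)) h1

/-- The doubling constant of an `A_p` weight in dimension `n`. -/
def apDoubling (n : ℕ) (p : ℝ) (A : ℝ≥0∞) : ℝ≥0∞ := A * ENNReal.ofReal (6 ^ n) ^ p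

/-- The `A_p` bound on the large ball is followed by Hölder on the small one. Doubling of `w` and of
its dual weight both follow by cancelling the other factor, which is positive and finite. -/
lemma BallAp.mul_dilate_le (hw : BallAp p A w) (hp : 1 < p)
    (c : E) {r : ℝ} (hr : 0 < r) :
    (∫⁻ x in ball c (6 * r), w x) * (∫⁻ x in ball c (6 * r), w x ^ (-1 / (p - 1))) ^ (p - 1) ≤
      apDoubling (Module.finrank ℝ E) p A * ((∫⁻ x in ball c r, w x) *
        (∫⁻ x in ball c r, w x ^ (-1 / (p - 1))) ^ (p - 1)) := by
  refine (hw.bound c (6 * r) (by positivity)).trans ?_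
  rw [volume_ball_mul c r (by norm_num), ENNReal.mul_rpow_of_nonneg _ _ (by linarith),
    ← mul_assoc, apDoubling]
  gcongr
  exact rpow_measure_le_mul_rpow hp hw.measurable hw.ae_ne_zero hw.ae_ne_top _

lemma BallAp.doubling (hw : BallAp p A w) (hp : 1 < p) (hA : A ≠ ∞)
    (c : E) (r : ℝ) (hr : 0 < r) :
    volume.withDensity w (ball c (6 * r)) ≤
      apDoubling (Module.finrank ℝ E) p A * volume.withDensity w (ball c r) := by
  have hp1 : 0 < p - 1 := by linarith
  rw [withDensity_apply _ measurableSet_ball, withDensity_apply _ measurableSet_ball]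
  have h6 : 0 < 6 * r := by positivity
  have h0 := hw.dual_lintegral_ne_zero c h6
  have ht := hw.dual_lintegral_ne_top hp hA c h6
  set S := ∫⁻ x in ball c (6 * r), w x ^ (-1 / (p - 1))
  have hS0 : S ^ (p - 1) ≠ 0 := (ENNReal.rpow_pos (pos_iff_ne_zero.2 h0) ht).ne'
  have hSt : S ^ (p - 1) ≠ ∞ := ENNReal.rpow_ne_top_of_nonneg hp1.le ht
  refine (ENNReal.mul_le_mul_iff_left hS0 hSt).1 ((hw.mul_dilate_le hp c hr).trans ?_)
  have hmono : ∫⁻ x in ball c r, w x ^ (-1 / (p - 1)) ≤ S :=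
    lintegral_mono_set (ball_subset_ball (by linarith))
  rw [mul_assoc]
  gcongr

lemma BallAp.dual_doubling (hw : BallAp p A w) (hp : 1 < p)
    (c : E) (r : ℝ) (hr : 0 < r) :
    volume.withDensity (fun x => w x ^ (-1 / (p - 1))) (ball c (6 * r)) ≤
      apDoubling (Module.finrank ℝ E) p A ^ (1 / (p - 1)) *
        volume.withDensity (fun x => w x ^ (-1 / (p - 1))) (ball c r) := by
  have hp1 : 0 < p - 1 := by linarith
  rw [withDensity_apply _ measurableSet_ball, withDensity_apply _ measurableSet_ball]
  have h6 : 0 < 6 * r := by positivity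
  have h0 := hw.lintegral_ne_zero c h6
  have ht := hw.lintegral_ne_top c (6 * r)
  rw [← ENNReal.rpow_le_rpow_iff hp1, ENNReal.mul_rpow_of_nonneg _ _ hp1.le, ← ENNReal.rpow_mul,
    one_div_mul_cancel hp1.ne', ENNReal.rpow_one]
  refine (ENNReal.mul_le_mul_iff_right h0 ht).1 ((hw.mul_dilate_le hp c hr).trans ?_)
  have hmono : ∫⁻ x in ball c r, w x ≤ ∫⁻ x in ball c (6 * r), w x :=
    lintegral_mono_set (ball_subset_ball (by linarith))
  rw [mul_left_comm]
  gcongr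

/-- The constant in Muckenhoupt's theorem. -/
def apMaxConst (n : ℕ) (p : ℝ) (A : ℝ≥0∞) : ℝ≥0∞ :=
  A ^ (p / (p - 1)) * (strongConst (p / (p - 1)) (apDoubling n p A) *
    strongConst p (apDoubling n p A ^ (1 / (p - 1))))

lemma apMaxConst_ne_top (hp : 1 < p) (hA : A ≠ ∞) (n : ℕ) : apMaxConst n p A ≠ ∞ := by
  have hp1 : 0 < p - 1 := by linarith
  have hq : 1 < p / (p - 1) := by rw [lt_div_iff₀ hp1]; linarith
  have hD : apDoubling n p A ≠ ∞ := ENNReal.mul_ne_top hA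
    (ENNReal.rpow_ne_top_of_nonneg (by linarith) ENNReal.ofReal_ne_top)
  exact ENNReal.mul_ne_top (ENNReal.rpow_ne_top_of_nonneg (by linarith) hA)
    (ENNReal.mul_ne_top (strongConst_ne_top hq hD)
      (strongConst_ne_top hp (ENNReal.rpow_ne_top_of_nonneg (by positivity) hD)))

/-- Lerner's pointwise bound of the maximal function by weighted maximal functions. -/
lemma BallAp.ballMax_rpow_le (hw : BallAp p A w) (hp : 1 < p) (hA : A ≠ ∞)
    {g : E → ℝ≥0∞} (hg : Measurable g) (x : E) :
    ballMax volume g x ^ (p - 1) ≤ A * ballMax (volume.withDensity w) (fun y =>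
      ballMax (volume.withDensity fun x => w x ^ (-1 / (p - 1)))
        (fun z => g z * (w z ^ (-1 / (p - 1)))⁻¹) y ^ (p - 1) * (w y)⁻¹) x := by
  have hp1 : 0 < p - 1 := by linarith
  set σ : E → ℝ≥0∞ := fun x => w x ^ (-1 / (p - 1)) with hσ
  have hσm : Measurable σ := hw.measurable.pow_const _
  set N := ballMax (volume.withDensity σ) (fun z => g z * (σ z)⁻¹) with hN
  have hNm : Measurable N := measurable_ballMax _ _
  rw [← ENNReal.le_rpow_inv_iff hp1]
  refine iSup_le fun i => ?_
  by_cases hx : x ∈ ratBall E i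
  swap
  · simp [hx]
  rw [indicator_of_mem hx, ENNReal.le_rpow_inv_iff hp1]
  refine le_trans ?_ (mul_le_mul_right (laverage_le_ballMax _ _ hx) A)
  have hr : (0 : ℝ) < i.2.1 := by exact_mod_cast i.2.2
  set B := ratBall E i with hB
  have hBm : MeasurableSet B := measurableSet_ball
  have hσ0 : ∫⁻ x in B, σ x ≠ 0 := hw.dual_lintegral_ne_zero _ hr
  have hσt : ∫⁻ x in B, σ x ≠ ∞ := hw.dual_lintegral_ne_top hp hA _ hr
  have hw0 : ∫⁻ x in B, w x ≠ 0 := hw.lintegral_ne_zero _ hr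
  have hwt : ∫⁻ x in B, w x ≠ ∞ := hw.lintegral_ne_top _ _
  have hB0 : volume B ≠ 0 := volume_ball_ne_zero _ hr
  have hBt : volume B ≠ ∞ := volume_ball_ne_top _ _
  have hgσ : ∫⁻ z in B, g z * (σ z)⁻¹ ∂(volume.withDensity σ) = ∫⁻ z in B, g z := by
    rw [setLIntegral_withDensity_eq_setLIntegral_mul _ hσm
      (g := fun z => g z * (σ z)⁻¹) (hg.mul hσm.inv) hBm]
    refine lintegral_congr_ae ?_
    filter_upwards [ae_restrict_of_ae (hw.ae_dual_ne_zero),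
      ae_restrict_of_ae (hw.ae_dual_ne_top)] with z h1 h2
    simp only [Pi.mul_apply]
    rw [mul_left_comm, ENNReal.mul_inv_cancel h1 h2, mul_one]
  have hNw : ∫⁻ y in B, N y ^ (p - 1) * (w y)⁻¹ ∂(volume.withDensity w) =
      ∫⁻ y in B, N y ^ (p - 1) := by
    rw [setLIntegral_withDensity_eq_setLIntegral_mul _ hw.measurable
      (g := fun y => N y ^ (p - 1) * (w y)⁻¹) ((hNm.pow_const _).mul hw.measurable.inv) hBm]
    refine lintegral_congr_ae ?_
    filter_upwards [ae_restrict_of_ae hw.ae_ne_zero, ae_restrict_of_ae hw.ae_ne_top] with z h1 h2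
    simp only [Pi.mul_apply]
    rw [mul_left_comm, ENNReal.mul_inv_cancel h1 h2, mul_one]
  -- The `σ`-mean of `g / σ` over `B`. Since `N` dominates it on all of `B`, `a^(p-1)` is at most
  -- the Lebesgue mean of `N^(p-1)` there; the `A_p` condition turns this into a `w`-mean of
  -- `N^(p-1) / w`.
  set a : ℝ≥0∞ := (∫⁻ z in B, g z) / ∫⁻ x in B, σ x with ha
  have haN : ∀ y ∈ B, a ≤ N y := by
    intro y hy
    refine le_trans (le_of_eq ?_) (laverage_le_ballMax _ _ hy)
    rw [setLAverage_eq, hgσ, withDensity_apply _ hBm]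
  have h1 : a ^ (p - 1) * volume B ≤ ∫⁻ y in B, N y ^ (p - 1) := by
    rw [← setLIntegral_const]
    refine setLIntegral_mono' hBm fun y hy => ?_
    gcongr
    exact haN y hy
  have h2 : ∫⁻ z in B, g z = a * ∫⁻ x in B, σ x := (ENNReal.div_mul_cancel hσ0 hσt).symm
  have h3 := hw.bound (TopologicalSpace.denseSeq E i.1) i.2.1 hr
  rw [setLAverage_eq, setLAverage_eq, hNw, withDensity_apply _ hBm, h2, ← mul_div_assoc,
    ENNReal.le_div_iff_mul_le (Or.inl hw0) (Or.inl hwt),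
    ENNReal.div_rpow_of_nonneg _ _ hp1.le, ENNReal.mul_rpow_of_nonneg _ _ hp1.le,
    ← ENNReal.mul_div_right_comm,
    ENNReal.div_le_iff (ENNReal.rpow_pos (pos_iff_ne_zero.2 hB0) hBt).ne'
      (ENNReal.rpow_ne_top_of_nonneg hp1.le hBt)]
  calc a ^ (p - 1) * (∫⁻ x in B, σ x) ^ (p - 1) * ∫⁻ x in B, w x
      = a ^ (p - 1) * ((∫⁻ x in B, w x) * (∫⁻ x in B, σ x) ^ (p - 1)) := by ring
    _ ≤ a ^ (p - 1) * (A * volume B ^ p) := mul_le_mul_right h3 _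
    _ = A * (a ^ (p - 1) * volume B) * volume B ^ (p - 1) := by
        have : volume B ^ p = volume B * volume B ^ (p - 1) := by
          conv_lhs => rw [show p = 1 + (p - 1) by ring, ENNReal.rpow_add _ _ hB0 hBt,
            ENNReal.rpow_one]
        rw [this]; ring
    _ ≤ A * (∫⁻ y in B, N y ^ (p - 1)) * volume B ^ (p - 1) := by gcongr

/-- **Muckenhoupt's theorem**: the maximal function is bounded on `L^p(w)` for `w ∈ A_p`. -/
theorem BallAp.lintegral_ballMax_rpow_mul_le (hw : BallAp p A w) (hp : 1 < p) (hA : A ≠ ∞)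
    {g : E → ℝ≥0∞} (hg : Measurable g) :
    ∫⁻ x, ballMax volume g x ^ p * w x ≤
      apMaxConst (Module.finrank ℝ E) p A * ∫⁻ x, g x ^ p * w x := by
  have hp0 : 0 < p := by linarith
  have hp1 : 0 < p - 1 := by linarith
  have hq : 1 < p / (p - 1) := by rw [lt_div_iff₀ hp1]; linarith
  have hq0 : 0 < p / (p - 1) := by positivity
  set σ : E → ℝ≥0∞ := fun x => w x ^ (-1 / (p - 1)) with hσ
  have hσm : Measurable σ := hw.measurable.pow_const _
  set N := ballMax (volume.withDensity σ) (fun z => g z * (σ z)⁻¹) with hN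
  have hNm : Measurable N := measurable_ballMax _ _
  set H : E → ℝ≥0∞ := fun y => N y ^ (p - 1) * (w y)⁻¹ with hH
  have hHm : Measurable H := (hNm.pow_const _).mul hw.measurable.inv
  have hpt : ∀ x, ballMax volume g x ^ p ≤
      A ^ (p / (p - 1)) * ballMax (volume.withDensity w) H x ^ (p / (p - 1)) := by
    intro x
    have h1 := hw.ballMax_rpow_le hp hA hg x
    calc ballMax volume g x ^ p = (ballMax volume g x ^ (p - 1)) ^ (p / (p - 1)) := by
          rw [← ENNReal.rpow_mul, mul_div_cancel₀ _ hp1.ne']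
      _ ≤ (A * ballMax (volume.withDensity w) H x) ^ (p / (p - 1)) := by gcongr
      _ = _ := ENNReal.mul_rpow_of_nonneg _ _ hq0.le
  have hAq : A ^ (p / (p - 1)) ≠ ∞ := ENNReal.rpow_ne_top_of_nonneg hq0.le hA
  have s1 : ∫⁻ x, ballMax volume g x ^ p * w x ≤ A ^ (p / (p - 1)) *
      ∫⁻ x, ballMax (volume.withDensity w) H x ^ (p / (p - 1)) ∂(volume.withDensity w) := by
    rw [lintegral_withDensity_eq_lintegral_mul _ hw.measurable
      ((measurable_ballMax _ _).pow_const _), ← lintegral_const_mul' _ _ hAq]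
    refine lintegral_mono fun x => ?_
    simp only [Pi.mul_apply]
    calc ballMax volume g x ^ p * w x
        ≤ (A ^ (p / (p - 1)) * ballMax (volume.withDensity w) H x ^ (p / (p - 1))) * w x := by
          gcongr; exact hpt x
      _ = _ := by ring
  have s2 := lintegral_ballMax_rpow_le (hw.doubling hp hA) hq hHm
  -- The exponents match: `w^(1 - p/(p-1)) = w^(-1/(p-1)) = σ`.
  have s3 : ∫⁻ x, H x ^ (p / (p - 1)) ∂(volume.withDensity w) =
      ∫⁻ x, N x ^ p ∂(volume.withDensity σ) := by
    rw [lintegral_withDensity_eq_lintegral_mul _ hw.measurable (hHm.pow_const _),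
      lintegral_withDensity_eq_lintegral_mul _ hσm (hNm.pow_const _)]
    refine lintegral_congr_ae ?_
    filter_upwards [hw.ae_ne_zero, hw.ae_ne_top] with x h1 h2
    simp only [Pi.mul_apply, hH, hσ]
    rw [ENNReal.mul_rpow_of_nonneg _ _ hq0.le, ← ENNReal.rpow_mul, mul_div_cancel₀ _ hp1.ne',
      ENNReal.inv_rpow, ← ENNReal.rpow_neg, mul_left_comm, mul_comm]
    congr 1
    conv_lhs => enter [1]; rw [← ENNReal.rpow_one (w x)]
    rw [← ENNReal.rpow_add _ _ h1 h2]
    congr 1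
    field_simp
    ring
  have s4 := lintegral_ballMax_rpow_le (hw.dual_doubling hp) hp (hg.mul hσm.inv)
  -- Here `σ^(1 - p) = w`, which closes the chain.
  have s5 : ∫⁻ x, (g x * (σ x)⁻¹) ^ p ∂(volume.withDensity σ) = ∫⁻ x, g x ^ p * w x := by
    rw [lintegral_withDensity_eq_lintegral_mul _ hσm
      (g := fun x => (g x * (σ x)⁻¹) ^ p) ((hg.mul hσm.inv).pow_const _)]
    refine lintegral_congr_ae ?_
    filter_upwards [hw.ae_ne_zero, hw.ae_ne_top] with x h1 h2
    simp only [Pi.mul_apply, hσ]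
    rw [ENNReal.mul_rpow_of_nonneg _ _ hp0.le, mul_left_comm, ENNReal.inv_rpow,
      ← ENNReal.rpow_neg, ← ENNReal.rpow_mul, ← ENNReal.rpow_add _ _ h1 h2]
    congr 1
    conv_rhs => rw [← ENNReal.rpow_one (w x)]
    congr 1
    field_simp
    ring
  calc ∫⁻ x, ballMax volume g x ^ p * w x
      ≤ A ^ (p / (p - 1)) * (strongConst (p / (p - 1)) (apDoubling (Module.finrank ℝ E) p A) *
        (strongConst p (apDoubling (Module.finrank ℝ E) p A ^ (1 / (p - 1))) *
          ∫⁻ x, g x ^ p * w x)) := by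
        refine s1.trans ?_
        gcongr
        refine s2.trans ?_
        gcongr
        rw [s3, ← s5]
        exact s4
    _ = _ := by rw [apMaxConst]; ring

end Muckenhoupt

/-! ### Maximal operators on functions of two variables. -/

section TwoVariables

set_option linter.unusedSectionVars false

variable {E : Type*} [NormedAddCommGroup E] [NormedSpace ℝ E] [FiniteDimensional ℝ E]
  [MeasureSpace E] [BorelSpace E] [(volume : Measure E).IsAddHaarMeasure]

/-- The maximal operator in the first variable. -/
def maxFst (F : E → E → ℝ≥0∞) (x y : E) : ℝ≥0∞ := ballMax volume (fun z => F z y) x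

/-- The maximal operator in the second variable. -/
def maxSnd (F : E → E → ℝ≥0∞) (x y : E) : ℝ≥0∞ := ballMax volume (fun z => F x z) y

/-- The maximal operator in the diagonal direction. -/
def maxDiag (F : E → E → ℝ≥0∞) (x y : E) : ℝ≥0∞ :=
  ballMax volume (fun z => F z (z - (x - y))) x

/-- The integral of `F x y ^ p` against the weight `w (x - y)`. -/
def weightedEnergy (p : ℝ) (w : E → ℝ≥0∞) (F : E → E → ℝ≥0∞) : ℝ≥0∞ :=
  ∫⁻ x, ∫⁻ y, F x y ^ p * w (x - y)

variable {F : E → E → ℝ≥0∞}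

lemma measurable_maxFst (hF : Measurable (Function.uncurry F)) :
    Measurable (Function.uncurry (maxFst F)) :=
  measurable_ballMax_prod volume hF

lemma measurable_maxSnd (hF : Measurable (Function.uncurry F)) :
    Measurable (Function.uncurry (maxSnd F)) :=
  (measurable_ballMax_prod volume (F := fun z x => F x z) (hF.comp measurable_swap)).comp
    measurable_swap

lemma measurable_sheared (hF : Measurable (Function.uncurry F)) :
    Measurable (Function.uncurry fun z h => F z (z - h)) :=
  hF.comp (measurable_fst.prodMk (measurable_fst.sub measurable_snd))

lemma measurable_maxDiag (hF : Measurable (Function.uncurry F)) :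
    Measurable (Function.uncurry (maxDiag F)) :=
  (measurable_ballMax_prod volume (measurable_sheared hF)).comp
    (measurable_fst.prodMk (measurable_fst.sub measurable_snd))

variable {p : ℝ} {A : ℝ≥0∞} {w : E → ℝ≥0∞}

lemma BallAp.comp_sub_left (hw : BallAp p A w) (x : E) : BallAp p A fun y => w (x - y) :=
  hw.comp (IsometryEquiv.subLeft x) (Measure.measurePreserving_sub_left volume x)

lemma BallAp.comp_sub_right (hw : BallAp p A w) (y : E) : BallAp p A fun x => w (x - y) :=
  hw.comp (IsometryEquiv.subRight y) (measurePreserving_sub_right volume y)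

lemma BallAp.comp_neg (hw : BallAp p A w) : BallAp p A fun x => w (-x) :=
  hw.comp (IsometryEquiv.neg E) (Measure.measurePreserving_neg volume)

lemma ballAp_one : BallAp p 1 fun _ : E => 1 := by
  refine ⟨measurable_const, by simp, by simp, fun c r => ?_, fun c r hr => ?_⟩
  · simpa using volume_ball_ne_top c r
  · have h0 := volume_ball_ne_zero c hr
    have ht := volume_ball_ne_top c r
    simp only [ENNReal.one_rpow, lintegral_const, one_mul, Measure.restrict_apply_univ]
    conv_rhs => rw [show p = 1 + (p - 1) by ring, ENNReal.rpow_add _ _ h0 ht, ENNReal.rpow_one]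

lemma measurable_energy_integrand (hw : Measurable w) (hF : Measurable (Function.uncurry F)) :
    Measurable (Function.uncurry fun x y => F x y ^ p * w (x - y)) :=
  (hF.pow_const p).mul (hw.comp (measurable_fst.sub measurable_snd))

lemma weightedEnergy_maxSnd_le (hw : BallAp p A w) (hp : 1 < p) (hA : A ≠ ∞)
    (hF : Measurable (Function.uncurry F)) :
    weightedEnergy p w (maxSnd F) ≤
      apMaxConst (Module.finrank ℝ E) p A * weightedEnergy p w F := by
  rw [weightedEnergy, weightedEnergy, ← lintegral_const_mul' _ _ (apMaxConst_ne_top hp hA _)]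
  exact lintegral_mono fun x => (hw.comp_sub_left x).lintegral_ballMax_rpow_mul_le hp hA
    (hF.comp measurable_prodMk_left)

lemma weightedEnergy_maxFst_le (hw : BallAp p A w) (hp : 1 < p) (hA : A ≠ ∞)
    (hF : Measurable (Function.uncurry F)) :
    weightedEnergy p w (maxFst F) ≤
      apMaxConst (Module.finrank ℝ E) p A * weightedEnergy p w F := by
  rw [weightedEnergy, weightedEnergy, lintegral_lintegral_swap
      (measurable_energy_integrand hw.measurable (measurable_maxFst hF)).aemeasurable,
    lintegral_lintegral_swap (measurable_energy_integrand hw.measurable hF).aemeasurable,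
    ← lintegral_const_mul' _ _ (apMaxConst_ne_top hp hA _)]
  exact lintegral_mono fun y => (hw.comp_sub_right y).lintegral_ballMax_rpow_mul_le hp hA
    (hF.comp measurable_prodMk_right)

/-- In the variables `x` and `h = x - y` the weight depends on `h` alone. -/
lemma weightedEnergy_eq_sheared (hw : Measurable w) (hF : Measurable (Function.uncurry F)) :
    weightedEnergy p w F = ∫⁻ h, w h * ∫⁻ x, F x (x - h) ^ p := by
  have hm := measurable_sheared hF
  have hm2 : Measurable (Function.uncurry fun x h => F x (x - h) ^ p * w h) :=
    (hm.pow_const p).mul (hw.comp measurable_snd)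
  calc weightedEnergy p w F = ∫⁻ x, ∫⁻ h, F x (x - h) ^ p * w h := by
        refine lintegral_congr fun x => ?_
        rw [← lintegral_sub_left_eq_self _ x]
        simp
    _ = ∫⁻ h, ∫⁻ x, F x (x - h) ^ p * w h := lintegral_lintegral_swap hm2.aemeasurable
    _ = _ := by
        refine lintegral_congr fun h => ?_
        rw [lintegral_mul_const (w h) (f := fun x => F x (x - h) ^ p)
          ((hm.comp measurable_prodMk_right).pow_const p), mul_comm]

/-- For fixed `h` the weight factors out, so Muckenhoupt's theorem is needed only for the weight
`1`, and `w` need not be an `A_p` weight. -/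
lemma weightedEnergy_maxDiag_le (hw : Measurable w) (hp : 1 < p)
    (hF : Measurable (Function.uncurry F)) :
    weightedEnergy p w (maxDiag F) ≤
      apMaxConst (Module.finrank ℝ E) p 1 * weightedEnergy p w F := by
  rw [weightedEnergy_eq_sheared hw (measurable_maxDiag hF), weightedEnergy_eq_sheared hw hF,
    ← lintegral_const_mul' _ _ (apMaxConst_ne_top hp ENNReal.one_ne_top _)]
  refine lintegral_mono fun h => ?_
  have := (ballAp_one (E := E) (p := p)).lintegral_ballMax_rpow_mul_le hp ENNReal.one_ne_top
    (g := fun x => F x (x - h)) ((measurable_sheared hF).comp measurable_prodMk_right)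
  simp only [mul_one] at this
  calc w h * ∫⁻ x, maxDiag F x (x - h) ^ p
      = w h * ∫⁻ x, ballMax volume (fun x => F x (x - h)) x ^ p := by simp [maxDiag]
    _ ≤ w h * (apMaxConst (Module.finrank ℝ E) p 1 * ∫⁻ x, F x (x - h) ^ p) := by gcongr
    _ = _ := by ring

end TwoVariables

/-! ### Ball averages and their parametrization by the unit ball. -/

section Averages

set_option linter.unusedSectionVars false

variable {E : Type*} [NormedAddCommGroup E] [NormedSpace ℝ E] [FiniteDimensional ℝ E]
  [MeasureSpace E] [BorelSpace E] [(volume : Measure E).IsAddHaarMeasure]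

/-- The comparison constant between averages over balls and the maximal function `ballMax`. -/
def ballConst (n : ℕ) : ℝ≥0∞ := ENNReal.ofReal (4 ^ n)

lemma laverage_ball_le_ballMax (g : E → ℝ≥0∞) {x c : E} {r : ℝ} (hr : 0 < r)
    (hx : dist x c ≤ 2 * r) :
    ⨍⁻ y in ball c r, g y ∂volume ≤ ballConst (Module.finrank ℝ E) * ballMax volume g x := by
  obtain ⟨k, hk⟩ := (TopologicalSpace.denseRange_denseSeq E).exists_dist_lt c hr
  -- The dense centre `c'` is within `r` of `c`, and `x` within `2r`, so a radius above `3r`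
  -- captures `x` and all of `ball c r`; a radius below `4r` keeps the volume ratio under `4^n`.
  obtain ⟨q, hq1, hq2⟩ := exists_rat_btwn (show 3 * r < 4 * r by linarith)
  have hq0 : 0 < q := by
    have : (0 : ℝ) < q := by linarith
    exact_mod_cast this
  set c' := TopologicalSpace.denseSeq E k
  have hxB : x ∈ ratBall E (k, ⟨q, hq0⟩) := by
    have := dist_triangle x c c'
    rw [ratBall, mem_ball]
    change dist x c' < q
    linarith
  have hsub : ball c r ⊆ ball c' q := ball_subset_ball' (by linarith)
  have hvol : volume (ball c' (q : ℝ)) ≤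
      ballConst (Module.finrank ℝ E) * volume (ball c r) := by
    rw [ballConst, Measure.addHaar_ball_center volume c, ← Measure.addHaar_ball_center volume c',
      ← volume_ball_mul c' r (by norm_num)]
    exact measure_mono (ball_subset_ball hq2.le)
  have hκ0 : ballConst (Module.finrank ℝ E) ≠ 0 := by
    simp only [ballConst, ne_eq, ENNReal.ofReal_eq_zero, not_le]; positivity
  have hκt : ballConst (Module.finrank ℝ E) ≠ ∞ := ENNReal.ofReal_ne_top
  calc ⨍⁻ y in ball c r, g y ∂volume
      = (∫⁻ y in ball c r, g y) * (volume (ball c r))⁻¹ := by rw [setLAverage_eq, div_eq_mul_inv]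
    _ ≤ (∫⁻ y in ball c' q, g y) *
          (ballConst (Module.finrank ℝ E) * (volume (ball c' (q : ℝ)))⁻¹) := by
        refine mul_le_mul' (lintegral_mono_set hsub) ?_
        have := ENNReal.inv_le_inv.2 hvol
        rw [ENNReal.mul_inv (Or.inl hκ0) (Or.inl hκt)] at this
        calc (volume (ball c r))⁻¹ = ballConst (Module.finrank ℝ E) *
              ((ballConst (Module.finrank ℝ E))⁻¹ * (volume (ball c r))⁻¹) := by
              rw [← mul_assoc, ENNReal.mul_inv_cancel hκ0 hκt, one_mul]
          _ ≤ _ := by gcongr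
    _ = ballConst (Module.finrank ℝ E) * ⨍⁻ y in ball c' q, g y ∂volume := by
        rw [setLAverage_eq, div_eq_mul_inv]; ring
    _ ≤ _ := by
        exact mul_le_mul_right (laverage_le_ballMax volume g hxB) _

/-- The uniform probability measure on the open unit ball. -/
def unitBallMeasure (E : Type*) [NormedAddCommGroup E] [MeasureSpace E] : Measure E :=
  (volume (ball (0 : E) 1))⁻¹ • volume.restrict (ball (0 : E) 1)

instance : IsProbabilityMeasure (unitBallMeasure E) := ⟨by
  simp [unitBallMeasure, ENNReal.inv_mul_cancel (volume_ball_ne_zero (0 : E) one_pos)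
    (volume_ball_ne_top _ _)]⟩

lemma ae_norm_lt_one : ∀ᵐ z ∂(unitBallMeasure E), ‖z‖ < 1 := by
  have : ∀ᵐ z ∂(volume.restrict (ball (0 : E) 1)), z ∈ ball (0 : E) 1 :=
    ae_restrict_mem measurableSet_ball
  filter_upwards [Measure.ae_smul_measure this _] with z hz
  simpa using hz

lemma lintegral_unitBallMeasure {g : E → ℝ≥0∞} (hg : Measurable g) (a : E) {r : ℝ} (hr : 0 < r) :
    ∫⁻ z, g (a + r • z) ∂(unitBallMeasure E) = ⨍⁻ y in ball a r, g y ∂volume := by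
  have hind : Measurable ((ball a r).indicator g) := hg.indicator measurableSet_ball
  have hrn : (0 : ℝ) < r ^ Module.finrank ℝ E := by positivity
  have h1 : ∫⁻ z in ball (0 : E) 1, g (a + r • z) =
      ENNReal.ofReal (r ^ Module.finrank ℝ E)⁻¹ * ∫⁻ y in ball a r, g y := by
    calc ∫⁻ z in ball (0 : E) 1, g (a + r • z)
        = ∫⁻ z, (ball a r).indicator g (a + r • z) := by
          rw [← lintegral_indicator measurableSet_ball]
          refine lintegral_congr fun z => ?_
          have : z ∈ ball (0 : E) 1 ↔ a + r • z ∈ ball a r := by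
            rw [mem_ball_zero_iff, mem_ball, dist_eq_norm, add_sub_cancel_left, norm_smul,
              Real.norm_of_nonneg hr.le, mul_lt_iff_lt_one_right hr]
          by_cases hz : z ∈ ball (0 : E) 1
          · rw [indicator_of_mem hz, indicator_of_mem (this.1 hz)]
          · rw [indicator_of_notMem hz, indicator_of_notMem (fun h => hz (this.2 h))]
      _ = ∫⁻ v, (ball a r).indicator g (a + v) ∂(Measure.map (r • ·) (volume : Measure E)) := by
          rw [lintegral_map (f := fun v => (ball a r).indicator g (a + v))
            (hind.comp (measurable_const_add a)) (measurable_const_smul r)]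
      _ = _ := by
          rw [Measure.map_addHaar_smul volume hr.ne', lintegral_smul_measure,
            lintegral_add_left_eq_self, lintegral_indicator measurableSet_ball,
            abs_of_nonneg (by positivity), smul_eq_mul]
  rw [unitBallMeasure, lintegral_smul_measure, h1, setLAverage_eq,
    Measure.addHaar_ball_of_pos volume a hr, smul_eq_mul, ENNReal.ofReal_inv_of_pos hrn,
    div_eq_mul_inv, ENNReal.mul_inv (Or.inr (volume_ball_ne_top _ _))
      (Or.inl ENNReal.ofReal_ne_top)]
  ring

end Averages

/-! ### Pointwise comparison of averages around `x` and `y`. -/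

section Pointwise

set_option linter.unusedSectionVars false

variable {E : Type*} [NormedAddCommGroup E] [NormedSpace ℝ E] [FiniteDimensional ℝ E]
  [MeasureSpace E] [BorelSpace E] [(volume : Measure E).IsAddHaarMeasure]
  {F : Type*} [NormedAddCommGroup F] {G : Set E} {s : ℝ} {f : E → F}

/-- The difference quotient of order `s` of `f`, cut off outside `G × G`. -/
def diffQuot (G : Set E) (s : ℝ) (f : E → F) (x y : E) : ℝ≥0∞ :=
  (G ×ˢ G).indicator (fun q : E × E => ‖f q.1 - f q.2‖ₑ / ENNReal.ofReal ‖q.1 - q.2‖ ^ s) (x, y)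

lemma measurable_diffQuot (hG : MeasurableSet G) (s : ℝ) (hf : StronglyMeasurable f) :
    Measurable (Function.uncurry (diffQuot G s f)) := by
  refine Measurable.indicator ?_ (hG.prod hG)
  have h1 : Measurable fun q : E × E => ‖f q.1 - f q.2‖ₑ :=
    ((hf.comp_measurable measurable_fst).sub (hf.comp_measurable measurable_snd)).enorm
  have h2 : Measurable fun q : E × E => ‖q.1 - q.2‖ :=
    (continuous_fst.sub continuous_snd).norm.measurable
  exact h1.div (h2.ennreal_ofReal.pow_const s)

lemma enorm_sub_le_diffQuot (hs : 0 ≤ s) {a b : E} (ha : a ∈ G) (hb : b ∈ G) {t : ℝ}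
    (h : ‖a - b‖ ≤ t) : ‖f a - f b‖ₑ ≤ ENNReal.ofReal t ^ s * diffQuot G s f a b := by
  rcases eq_or_ne a b with rfl | hab
  · simp
  have h0 : 0 < ENNReal.ofReal ‖a - b‖ := by simpa [sub_eq_zero] using hab
  have hq : diffQuot G s f a b = ‖f a - f b‖ₑ / ENNReal.ofReal ‖a - b‖ ^ s :=
    indicator_of_mem (mk_mem_prod ha hb) _
  rw [hq]
  calc ‖f a - f b‖ₑ = ENNReal.ofReal ‖a - b‖ ^ s *
        (‖f a - f b‖ₑ / ENNReal.ofReal ‖a - b‖ ^ s) :=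
        (ENNReal.mul_div_cancel (ENNReal.rpow_pos h0 ENNReal.ofReal_ne_top).ne'
          (ENNReal.rpow_ne_top_of_nonneg hs ENNReal.ofReal_ne_top)).symm
    _ ≤ _ := by gcongr

lemma enorm_le_add_enorm_sub (a b : F) : ‖a‖ₑ ≤ ‖b‖ₑ + ‖a - b‖ₑ := by
  calc ‖a‖ₑ = ‖b + (a - b)‖ₑ := by congr 1; abel
    _ ≤ _ := enorm_add_le _ _

/-- When `r ≤ d`, every point of `ball x r` is within `2d` of `y`, so the value at `y` already
serves for comparison. -/
lemma laverage_ball_le_of_le (hG : MeasurableSet G) (hs : 0 ≤ s) (hf : StronglyMeasurable f)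
    {x y : E} {r d : ℝ} (hr : 0 < r) (hrd : r ≤ d) (hxy : ‖x - y‖ ≤ d) (hy : y ∈ G)
    (hball : ball x r ⊆ G) :
    ⨍⁻ z in ball x r, ‖f z‖ₑ ∂volume ≤ ‖f y‖ₑ + ENNReal.ofReal (2 * d) ^ s *
      (ballConst (Module.finrank ℝ E) * maxFst (diffQuot G s f) x y) := by
  have hS := measurable_diffQuot hG s hf
  have hSy : Measurable fun z => diffQuot G s f z y := hS.comp measurable_prodMk_right
  rw [← lintegral_unitBallMeasure hf.enorm x hr]
  calc ∫⁻ z, ‖f (x + r • z)‖ₑ ∂(unitBallMeasure E)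
      ≤ ∫⁻ z, (‖f y‖ₑ + ENNReal.ofReal (2 * d) ^ s * diffQuot G s f (x + r • z) y)
          ∂(unitBallMeasure E) := by
        refine lintegral_mono_ae ?_
        filter_upwards [ae_norm_lt_one (E := E)] with z hz
        have hz1 : r * ‖z‖ < r := by nlinarith
        refine (enorm_le_add_enorm_sub _ (f y)).trans ?_
        gcongr
        refine enorm_sub_le_diffQuot hs (hball ?_) hy ?_
        · rwa [mem_ball, dist_eq_norm, add_sub_cancel_left, norm_smul, Real.norm_of_nonneg hr.le]
        · calc ‖x + r • z - y‖ = ‖(x - y) + r • z‖ := by congr 1; abel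
            _ ≤ ‖x - y‖ + ‖r • z‖ := norm_add_le _ _
            _ ≤ 2 * d := by rw [norm_smul, Real.norm_of_nonneg hr.le]; linarith
    _ = ‖f y‖ₑ + ENNReal.ofReal (2 * d) ^ s * ⨍⁻ z in ball x r, diffQuot G s f z y ∂volume := by
        rw [lintegral_add_left measurable_const, lintegral_const, measure_univ, mul_one,
          lintegral_const_mul' _ _ (ENNReal.rpow_ne_top_of_nonneg hs ENNReal.ofReal_ne_top), ← lintegral_unitBallMeasure hSy x hr]
    _ ≤ _ := by
        gcongr
        exact laverage_ball_le_ballMax _ hr (by simpa using hr.le)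

/-- The pairs `(x + t z, y + t z)` all have difference `x - y`, so this is an average along one
diagonal line of directions. -/
lemma lintegral_translate_le_maxDiag {Φ : E → E → ℝ≥0∞} (hΦ : Measurable (Function.uncurry Φ))
    (x y : E) {t : ℝ} (ht : 0 < t) :
    ∫⁻ z, Φ (x + t • z) (y + t • z) ∂(unitBallMeasure E) ≤
      ballConst (Module.finrank ℝ E) * maxDiag Φ x y := by
  have hm : Measurable fun v => Φ v (v - (x - y)) :=
    hΦ.comp (measurable_id.prodMk (measurable_id.sub_const _))
  calc ∫⁻ z, Φ (x + t • z) (y + t • z) ∂(unitBallMeasure E)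
      = ∫⁻ z, (fun v => Φ v (v - (x - y))) (x + t • z) ∂(unitBallMeasure E) := by
        refine lintegral_congr fun z => ?_
        simp only
        congr 1
        abel
    _ = ⨍⁻ v in ball x t, Φ v (v - (x - y)) ∂volume := lintegral_unitBallMeasure hm x ht
    _ ≤ _ := laverage_ball_le_ballMax _ ht (by simpa using ht.le)

/-- The jump from `x + r z` to `y + (r - d) z` passes through a point averaged over `ball (x + (r -
d) z) d`, which lies in `ball x r`. Each half of the jump becomes a one-variable maximal function at
a pair with difference `x - y`. -/
lemma enorm_le_enorm_add_maxSnd_add_maxFst (hG : MeasurableSet G) (hs : 0 ≤ s)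
    (hf : StronglyMeasurable f) {x y : E} {r d : ℝ} (hd : 0 < d) (hdr : d < r)
    (hxy : ‖x - y‖ ≤ d) (hx : ball x r ⊆ G) (hy : ball y (r - d) ⊆ G) {z : E} (hz : ‖z‖ < 1) :
    ‖f (x + r • z)‖ₑ ≤ ‖f (y + (r - d) • z)‖ₑ + ENNReal.ofReal (2 * d) ^ s *
      (ballConst (Module.finrank ℝ E) * (maxSnd (diffQuot G s f) (x + r • z) (y + r • z) +
        maxFst (diffQuot G s f) (x + (r - d) • z) (y + (r - d) • z))) := by
  have hS := measurable_diffQuot hG s hf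
  set S := diffQuot G s f with hSdef
  set T := ENNReal.ofReal (2 * d) ^ s with hT
  have hTt : T ≠ ∞ := ENNReal.rpow_ne_top_of_nonneg hs ENNReal.ofReal_ne_top
  set ρ := r - d with hρ
  have hρ0 : 0 < ρ := by simp only [hρ]; linarith
  have hr : 0 < r := by linarith
  have hz0 := norm_nonneg z
  have hz1 : d * ‖z‖ ≤ d := mul_le_of_le_one_right hd.le hz.le
  have hz2 : r * ‖z‖ < r := mul_lt_of_lt_one_right hr hz
  have hz3 : ρ * ‖z‖ < ρ := mul_lt_of_lt_one_right hρ0 hz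
  have hrz : ‖r • z‖ = r * ‖z‖ := by rw [norm_smul, Real.norm_of_nonneg hr.le]
  have hρz : ‖ρ • z‖ = ρ * ‖z‖ := by rw [norm_smul, Real.norm_of_nonneg hρ0.le]
  have hdz : ‖d • z‖ = d * ‖z‖ := by rw [norm_smul, Real.norm_of_nonneg hd.le]
  have ma : x + r • z ∈ G := hx <| by
    rw [mem_ball, dist_eq_norm, add_sub_cancel_left, hrz]; exact hz2
  have mb : y + ρ • z ∈ G := hy <| by
    rw [mem_ball, dist_eq_norm, add_sub_cancel_left, hρz]; exact hz3
  have hS1 : Measurable fun v => S (x + r • z) v := hS.comp measurable_prodMk_left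
  have hS2 : Measurable fun v => S v (y + ρ • z) := hS.comp measurable_prodMk_right
  have hmw : Measurable fun w : E => (x + ρ • z) + d • w := by fun_prop
  have hS3 : Measurable fun w => S (x + r • z) ((x + ρ • z) + d • w) := hS1.comp hmw
  calc ‖f (x + r • z)‖ₑ = ∫⁻ _, ‖f (x + r • z)‖ₑ ∂(unitBallMeasure E) := by simp
    _ ≤ ∫⁻ w, (‖f (y + ρ • z)‖ₑ + T * (S (x + r • z) ((x + ρ • z) + d • w) +
          S ((x + ρ • z) + d • w) (y + ρ • z))) ∂(unitBallMeasure E) := by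
        refine lintegral_mono_ae ?_
        filter_upwards [ae_norm_lt_one (E := E)] with w hw
        have hdw : ‖d • w‖ = d * ‖w‖ := by rw [norm_smul, Real.norm_of_nonneg hd.le]
        have hw1 : d * ‖w‖ < d := mul_lt_of_lt_one_right hd hw
        have mc : (x + ρ • z) + d • w ∈ G := hx <| by
          rw [mem_ball, dist_eq_norm, add_assoc, add_sub_cancel_left]
          calc ‖ρ • z + d • w‖ ≤ ‖ρ • z‖ + ‖d • w‖ := norm_add_le _ _
            _ < r := by rw [hρz, hdw]; linarith
        have n1 : ‖x + r • z - ((x + ρ • z) + d • w)‖ ≤ 2 * d := by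
          calc ‖x + r • z - ((x + ρ • z) + d • w)‖ = ‖d • z - d • w‖ := by
                congr 1; rw [hρ, sub_smul]; abel
            _ ≤ ‖d • z‖ + ‖d • w‖ := norm_sub_le _ _
            _ ≤ 2 * d := by rw [hdz, hdw]; linarith
        have n2 : ‖(x + ρ • z) + d • w - (y + ρ • z)‖ ≤ 2 * d := by
          calc ‖(x + ρ • z) + d • w - (y + ρ • z)‖ = ‖(x - y) + d • w‖ := by congr 1; abel
            _ ≤ ‖x - y‖ + ‖d • w‖ := norm_add_le _ _
            _ ≤ 2 * d := by rw [hdw]; linarith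
        have e1 := enorm_le_add_enorm_sub (f (x + r • z)) (f ((x + ρ • z) + d • w))
        have e2 := enorm_le_add_enorm_sub (f ((x + ρ • z) + d • w)) (f (y + ρ • z))
        have e3 : ‖f (x + r • z) - f ((x + ρ • z) + d • w)‖ₑ ≤
          T * S (x + r • z) ((x + ρ • z) + d • w) := enorm_sub_le_diffQuot hs ma mc n1
        have e4 : ‖f ((x + ρ • z) + d • w) - f (y + ρ • z)‖ₑ ≤
          T * S ((x + ρ • z) + d • w) (y + ρ • z) := enorm_sub_le_diffQuot hs mc mb n2
        calc ‖f (x + r • z)‖ₑ ≤ (‖f (y + ρ • z)‖ₑ + T * S ((x + ρ • z) + d • w) (y + ρ • z)) +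
              T * S (x + r • z) ((x + ρ • z) + d • w) :=
              e1.trans (add_le_add (e2.trans (add_le_add le_rfl e4)) e3)
          _ = _ := by ring
    _ = ‖f (y + ρ • z)‖ₑ + T * (⨍⁻ v in ball (x + ρ • z) d, S (x + r • z) v ∂volume +
          ⨍⁻ v in ball (x + ρ • z) d, S v (y + ρ • z) ∂volume) := by
        rw [lintegral_add_left measurable_const, lintegral_const, measure_univ, mul_one,
          lintegral_const_mul' _ _ hTt, lintegral_add_left hS3,
          ← lintegral_unitBallMeasure hS1 _ hd, ← lintegral_unitBallMeasure hS2 _ hd]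
    _ ≤ _ := by
        rw [mul_add (ballConst _)]
        refine add_le_add le_rfl (mul_le_mul_right (add_le_add ?_ ?_) T)
        -- The maximal function is evaluated at `y + r z`, which need not lie in `G`: it only has to
        -- be within `2d` of the centre `x + ρ z`.
        · refine laverage_ball_le_ballMax (fun v => S (x + r • z) v) hd ?_
          rw [dist_eq_norm]
          calc ‖y + r • z - (x + ρ • z)‖ = ‖(y - x) + d • z‖ := by
                congr 1; rw [hρ, sub_smul]; abel
            _ ≤ ‖y - x‖ + ‖d • z‖ := norm_add_le _ _
            _ ≤ 2 * d := by rw [norm_sub_rev, hdz]; linarith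
        · exact laverage_ball_le_ballMax (fun v => S v (y + ρ • z)) hd (by simpa using hd.le)

lemma measurable_comp_uncurry {α β γ δ : Type*} [MeasurableSpace α] [MeasurableSpace β]
    [MeasurableSpace γ] [MeasurableSpace δ] {Φ : α → β → γ} (hΦ : Measurable (Function.uncurry Φ))
    {u : δ → α} {v : δ → β} (hu : Measurable u) (hv : Measurable v) :
    Measurable fun z => Φ (u z) (v z) :=
  hΦ.comp (hu.prodMk hv)

lemma laverage_ball_le_laverage_ball_add (hG : MeasurableSet G) (hs : 0 ≤ s)
    (hf : StronglyMeasurable f) {x y : E} {r d : ℝ} (hd : 0 < d) (hdr : d < r)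
    (hxy : ‖x - y‖ ≤ d) (hx : ball x r ⊆ G) (hy : ball y (r - d) ⊆ G) :
    ⨍⁻ z in ball x r, ‖f z‖ₑ ∂volume ≤ ⨍⁻ z in ball y (r - d), ‖f z‖ₑ ∂volume +
      ENNReal.ofReal (2 * d) ^ s * (ballConst (Module.finrank ℝ E) ^ 2 *
        (maxDiag (maxSnd (diffQuot G s f)) x y + maxDiag (maxFst (diffQuot G s f)) x y)) := by
  have hS := measurable_diffQuot hG s hf
  have hinner := fun z hz =>
    enorm_le_enorm_add_maxSnd_add_maxFst hG hs hf hd hdr hxy hx hy (z := z) hz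
  set S := diffQuot G s f with hSdef
  set κ := ballConst (Module.finrank ℝ E) with hκ
  set T := ENNReal.ofReal (2 * d) ^ s with hT
  have hκt : κ ≠ ∞ := ENNReal.ofReal_ne_top
  have hTt : T ≠ ∞ := ENNReal.rpow_ne_top_of_nonneg hs ENNReal.ofReal_ne_top
  have hρ0 : 0 < r - d := by linarith
  have hr : 0 < r := by linarith
  have hF := measurable_maxFst hS
  have hN := measurable_maxSnd hS
  have hf' : Measurable fun z : E => ‖f (y + (r - d) • z)‖ₑ :=
    hf.enorm.comp (by fun_prop : Measurable fun z : E => y + (r - d) • z)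
  have hN' : Measurable fun z : E => maxSnd S (x + r • z) (y + r • z) :=
    measurable_comp_uncurry hN ((measurable_const_smul r).const_add x) ((measurable_const_smul r).const_add y)
  rw [← lintegral_unitBallMeasure hf.enorm x hr]
  calc ∫⁻ z, ‖f (x + r • z)‖ₑ ∂(unitBallMeasure E)
      ≤ ∫⁻ z, (‖f (y + (r - d) • z)‖ₑ + T * (κ * (maxSnd S (x + r • z) (y + r • z) +
          maxFst S (x + (r - d) • z) (y + (r - d) • z)))) ∂(unitBallMeasure E) := by
        refine lintegral_mono_ae ?_
        filter_upwards [ae_norm_lt_one (E := E)] with z hz using hinner z hz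
    _ = ⨍⁻ z in ball y (r - d), ‖f z‖ₑ ∂volume + T * (κ *
          (∫⁻ z, maxSnd S (x + r • z) (y + r • z) ∂(unitBallMeasure E) +
            ∫⁻ z, maxFst S (x + (r - d) • z) (y + (r - d) • z) ∂(unitBallMeasure E))) := by
        rw [lintegral_add_left hf', lintegral_const_mul' _ _ hTt,
          lintegral_const_mul' _ _ hκt, lintegral_add_left hN',
          ← lintegral_unitBallMeasure hf.enorm y hρ0]
    _ ≤ ⨍⁻ z in ball y (r - d), ‖f z‖ₑ ∂volume +
          T * (κ * (κ * maxDiag (maxSnd S) x y + κ * maxDiag (maxFst S) x y)) :=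
        add_le_add le_rfl (mul_le_mul_right (mul_le_mul_right (add_le_add
          (lintegral_translate_le_maxDiag hN x y hr)
          (lintegral_translate_le_maxDiag hF x y hρ0)) κ) T)
    _ = _ := by ring

/-- A ball missing the frontier is covered by the disjoint open sets `G` and the complement of its
closure; being connected and meeting `G`, it lies in `G`. -/
lemma ball_subset_of_le_infEDist_frontier (hG : IsOpen G) {x : E} (hx : x ∈ G) {r : ℝ}
    (h : ENNReal.ofReal r ≤ infEDist x (frontier G)) : ball x r ⊆ G := by
  rcases le_or_gt r 0 with hr | hr
  · simp [ball_eq_empty.2 hr]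
  refine IsPreconnected.subset_left_of_subset_union hG isClosed_closure.isOpen_compl
    (disjoint_compl_right.mono_left subset_closure) (fun z hz => ?_)
    ⟨x, mem_ball_self hr, hx⟩ isPreconnected_ball
  by_contra hcon
  rw [mem_union, not_or, notMem_compl_iff] at hcon
  have hzf : z ∈ frontier G := by
    rw [hG.frontier_eq]
    exact ⟨hcon.2, hcon.1⟩
  have h1 : ENNReal.ofReal r ≤ edist x z := h.trans (infEDist_le_edist_of_mem hzf)
  rw [edist_dist, ENNReal.ofReal_le_ofReal_iff dist_nonneg, dist_comm] at h1
  exact absurd hz (not_lt.2 h1)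

/-- The majorant in the pointwise estimate of the maximal function. -/
def majorant (S : E → E → ℝ≥0∞) (x y : E) : ℝ≥0∞ :=
  S x y + ballConst (Module.finrank ℝ E) * maxFst S x y +
    ballConst (Module.finrank ℝ E) ^ 2 * (maxDiag (maxSnd S) x y + maxDiag (maxFst S) x y)

end Pointwise

/-! ### The pointwise estimate for `M_R`. -/

section Maximal

variable {n : ℕ} {𝕜 : Type*} [RCLike 𝕜] {G : Set (EuclideanSpace ℝ (Fin n))} {s : ℝ}
  {f g : EuclideanSpace ℝ (Fin n) → 𝕜}

lemma ballAverage_congr (hfg : ∀ᵐ z, z ∈ G → f z = g z) {x : EuclideanSpace ℝ (Fin n)} {r : ℝ}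
    (hx : f x = g x) (hball : ball x r ⊆ G) : ballAverage f x r = ballAverage g x r := by
  unfold ballAverage
  split_ifs
  · rw [hx]
  · refine setLAverage_congr_fun_ae measurableSet_ball ?_
    filter_upwards [hfg] with z hz hzb
    rw [hz (hball hzb)]

/-- Each radius admissible at `x` gets a competitor at `y`: radius `0` when `r ≤ d`, and `r - d`
otherwise. The term `|R x - R y|` in `d` is what makes `r - d ≤ R y`. -/
lemma maximalFunction_le_add_majorant (hG : IsOpen G) (hs : 0 ≤ s)
    {R : EuclideanSpace ℝ (Fin n) → ℝ}
    (hR : ∀ x ∈ G, 0 ≤ R x ∧ ENNReal.ofReal (R x) ≤ infEDist x (frontier G))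
    (hg : StronglyMeasurable g) (hfg : ∀ᵐ z, z ∈ G → f z = g z)
    {x y : EuclideanSpace ℝ (Fin n)} (hx : x ∈ G) (hy : y ∈ G) (hfx : f x = g x) (hfy : f y = g y)
    (hxy : x ≠ y) :
    maximalFunction R f x ≤ maximalFunction R f y +
      ENNReal.ofReal (2 * (‖x - y‖ + |R x - R y|)) ^ s * majorant (diffQuot G s g) x y := by
  set d := ‖x - y‖ + |R x - R y| with hd
  have hd0 : 0 < d := add_pos_of_pos_of_nonneg (norm_pos_iff.2 (sub_ne_zero.2 hxy)) (abs_nonneg _)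
  have hxyd : ‖x - y‖ ≤ d := le_add_of_nonneg_right (abs_nonneg _)
  have hRx := ball_subset_of_le_infEDist_frontier hG hx (hR x hx).2
  have hRy := ball_subset_of_le_infEDist_frontier hG hy (hR y hy).2
  have hfy0 : ‖g y‖ₑ ≤ maximalFunction R f y := by
    refine le_trans ?_ (le_iSup₂ (0 : ℝ) ⟨le_rfl, (hR y hy).1⟩)
    simp [ballAverage, hfy]
  refine iSup₂_le fun r hr => ?_
  have hballx : ball x r ⊆ G := (ball_subset_ball hr.2).trans hRx
  rw [ballAverage_congr hfg hfx hballx]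
  rcases eq_or_lt_of_le hr.1 with rfl | hr0
  · rw [ballAverage, if_pos rfl]
    refine (enorm_le_add_enorm_sub _ (g y)).trans (add_le_add hfy0 ?_)
    refine (enorm_sub_le_diffQuot hs hx hy (t := 2 * d) (by linarith)).trans ?_
    gcongr
    rw [majorant, add_assoc]
    exact le_self_add
  rw [ballAverage, if_neg hr0.ne']
  rcases le_or_gt r d with hrd | hdr
  · refine (laverage_ball_le_of_le hG.measurableSet hs hg hr0 hrd hxyd hy hballx).trans ?_
    gcongr
    rw [majorant]
    exact le_add_right le_add_self
  · have hρ : r - d ≤ R y := by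
      have := le_abs_self (R x - R y)
      have := norm_nonneg (x - y)
      linarith [hr.2]
    have hbally : ball y (r - d) ⊆ G := (ball_subset_ball hρ).trans hRy
    refine (laverage_ball_le_laverage_ball_add hG.measurableSet hs hg hd0 hdr hxyd hballx
      hbally).trans ?_
    gcongr
    · refine le_trans (le_of_eq ?_) (le_iSup₂ (r - d) ⟨by linarith, hρ⟩)
      rw [ballAverage_congr hfg hfy hbally, ballAverage, if_neg (by linarith)]
    · rw [majorant]
      exact le_add_self

end Maximal

/-! ### Weighted `L^p` bounds for the majorant. -/

section Energy

set_option linter.unusedSectionVars false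

variable {E : Type*} [NormedAddCommGroup E] [NormedSpace ℝ E] [FiniteDimensional ℝ E]
  [MeasureSpace E] [BorelSpace E] [(volume : Measure E).IsAddHaarMeasure]
  {p : ℝ} {A : ℝ≥0∞} {w : E → ℝ≥0∞}

lemma weightedEnergy_add_le (hp : 1 ≤ p) (hw : Measurable w) {Φ Ψ : E → E → ℝ≥0∞}
    (hΦ : Measurable (Function.uncurry Φ)) :
    weightedEnergy p w (fun x y => Φ x y + Ψ x y) ≤
      2 ^ (p - 1) * (weightedEnergy p w Φ + weightedEnergy p w Ψ) := by
  have h2 : (2 : ℝ≥0∞) ^ (p - 1) ≠ ∞ := ENNReal.rpow_ne_top_of_nonneg (by linarith) (by simp)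
  have hm := measurable_energy_integrand (p := p) hw hΦ
  unfold weightedEnergy
  rw [← lintegral_add_left (Measurable.lintegral_prod_right
    (f := fun x y => Φ x y ^ p * w (x - y)) hm), ← lintegral_const_mul' _ _ h2]
  refine lintegral_mono fun x => ?_
  rw [← lintegral_add_left (f := fun y => Φ x y ^ p * w (x - y)) (hm.comp measurable_prodMk_left),
    ← lintegral_const_mul' _ _ h2]
  refine lintegral_mono fun y => ?_
  rw [← add_mul, ← mul_assoc]
  gcongr
  exact ENNReal.rpow_add_le_mul_rpow_add_rpow _ _ hp

lemma weightedEnergy_const_mul (hp : 0 ≤ p) {c : ℝ≥0∞} (hc : c ≠ ∞) (Φ : E → E → ℝ≥0∞) :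
    weightedEnergy p w (fun x y => c * Φ x y) = c ^ p * weightedEnergy p w Φ := by
  have h2 : c ^ p ≠ ∞ := ENNReal.rpow_ne_top_of_nonneg hp hc
  unfold weightedEnergy
  rw [← lintegral_const_mul' _ _ h2]
  refine lintegral_congr fun x => ?_
  rw [← lintegral_const_mul' _ _ h2]
  refine lintegral_congr fun y => ?_
  rw [ENNReal.mul_rpow_of_nonneg _ _ hp, mul_assoc]

/-- The constant in the energy estimate of the majorant. -/
def majorantConst (n : ℕ) (p : ℝ) (A : ℝ≥0∞) : ℝ≥0∞ :=
  2 ^ (p - 1) * (2 ^ (p - 1) * (1 + ballConst n ^ p * apMaxConst n p A) +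
    (ballConst n ^ 2) ^ p * (2 ^ (p - 1) * (2 * (apMaxConst n p 1 * apMaxConst n p A))))

lemma majorantConst_ne_top (hp : 1 < p) (hA : A ≠ ∞) (n : ℕ) : majorantConst n p A ≠ ∞ := by
  have h2 : (2 : ℝ≥0∞) ^ (p - 1) ≠ ∞ := ENNReal.rpow_ne_top_of_nonneg (by linarith) (by simp)
  have hκ : ballConst n ≠ ∞ := ENNReal.ofReal_ne_top
  have hp0 : 0 ≤ p := by linarith
  have hK := apMaxConst_ne_top hp hA n
  have hK1 := apMaxConst_ne_top hp ENNReal.one_ne_top n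
  have hκp : ballConst n ^ p ≠ ∞ := ENNReal.rpow_ne_top_of_nonneg hp0 hκ
  have hκp2 : (ballConst n ^ 2) ^ p ≠ ∞ :=
    ENNReal.rpow_ne_top_of_nonneg hp0 (ENNReal.pow_ne_top hκ)
  exact ENNReal.mul_ne_top h2 (ENNReal.add_ne_top.2
    ⟨ENNReal.mul_ne_top h2 (ENNReal.add_ne_top.2 ⟨by simp, ENNReal.mul_ne_top hκp hK⟩),
      ENNReal.mul_ne_top hκp2 (ENNReal.mul_ne_top h2 (ENNReal.mul_ne_top (by simp)
        (ENNReal.mul_ne_top hK1 hK)))⟩)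

lemma measurable_majorant {S : E → E → ℝ≥0∞} (hS : Measurable (Function.uncurry S)) :
    Measurable (Function.uncurry (majorant S)) :=
  (hS.add ((measurable_maxFst hS).const_mul _)).add
    (((measurable_maxDiag (measurable_maxSnd hS)).add
      (measurable_maxDiag (measurable_maxFst hS))).const_mul _)

lemma weightedEnergy_majorant_le (hw : BallAp p A w) (hp : 1 < p) (hA : A ≠ ∞)
    {S : E → E → ℝ≥0∞} (hS : Measurable (Function.uncurry S)) :
    weightedEnergy p w (majorant S) ≤
      majorantConst (Module.finrank ℝ E) p A * weightedEnergy p w S := by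
  have hp0 : 0 ≤ p := by linarith
  have hF := measurable_maxFst hS
  have hN := measurable_maxSnd hS
  have hκ : ballConst (Module.finrank ℝ E) ≠ ∞ := ENNReal.ofReal_ne_top
  have hF' : Measurable (Function.uncurry fun x y : E =>
      ballConst (Module.finrank ℝ E) * maxFst S x y) := hF.const_mul _
  have h1 : weightedEnergy p w (maxDiag (maxSnd S)) ≤ apMaxConst (Module.finrank ℝ E) p 1 *
      (apMaxConst (Module.finrank ℝ E) p A * weightedEnergy p w S) :=
    (weightedEnergy_maxDiag_le hw.measurable hp hN).trans
      (mul_le_mul_right (weightedEnergy_maxSnd_le hw hp hA hS) _)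
  have h2 : weightedEnergy p w (maxDiag (maxFst S)) ≤ apMaxConst (Module.finrank ℝ E) p 1 *
      (apMaxConst (Module.finrank ℝ E) p A * weightedEnergy p w S) :=
    (weightedEnergy_maxDiag_le hw.measurable hp hF).trans
      (mul_le_mul_right (weightedEnergy_maxFst_le hw hp hA hS) _)
  have h3 : weightedEnergy p w (fun x y => S x y + ballConst (Module.finrank ℝ E) * maxFst S x y) ≤
      2 ^ (p - 1) * (weightedEnergy p w S + ballConst (Module.finrank ℝ E) ^ p *
        (apMaxConst (Module.finrank ℝ E) p A * weightedEnergy p w S)) := by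
    refine (weightedEnergy_add_le hp.le hw.measurable hS).trans ?_
    rw [weightedEnergy_const_mul hp0 hκ]
    gcongr
    exact weightedEnergy_maxFst_le hw hp hA hS
  have h4 : weightedEnergy p w (fun x y => maxDiag (maxSnd S) x y + maxDiag (maxFst S) x y) ≤
      2 ^ (p - 1) * (apMaxConst (Module.finrank ℝ E) p 1 *
          (apMaxConst (Module.finrank ℝ E) p A * weightedEnergy p w S) +
        apMaxConst (Module.finrank ℝ E) p 1 *
          (apMaxConst (Module.finrank ℝ E) p A * weightedEnergy p w S)) := by
    refine (weightedEnergy_add_le hp.le hw.measurable (measurable_maxDiag hN)).trans ?_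
    gcongr
  calc weightedEnergy p w (majorant S)
      ≤ 2 ^ (p - 1) * (weightedEnergy p w
          (fun x y => S x y + ballConst (Module.finrank ℝ E) * maxFst S x y) +
        weightedEnergy p w (fun x y => ballConst (Module.finrank ℝ E) ^ 2 *
          (maxDiag (maxSnd S) x y + maxDiag (maxFst S) x y))) :=
        weightedEnergy_add_le hp.le hw.measurable (hS.add hF')
    _ ≤ 2 ^ (p - 1) * (2 ^ (p - 1) * (weightedEnergy p w S +
          ballConst (Module.finrank ℝ E) ^ p *
            (apMaxConst (Module.finrank ℝ E) p A * weightedEnergy p w S)) +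
          (ballConst (Module.finrank ℝ E) ^ 2) ^ p * (2 ^ (p - 1) *
        (apMaxConst (Module.finrank ℝ E) p 1 *
          (apMaxConst (Module.finrank ℝ E) p A * weightedEnergy p w S) +
        apMaxConst (Module.finrank ℝ E) p 1 *
          (apMaxConst (Module.finrank ℝ E) p A * weightedEnergy p w S)))) := by
        rw [weightedEnergy_const_mul hp0 (ENNReal.pow_ne_top hκ)]
        gcongr
    _ = _ := by rw [majorantConst]; ring

/-- The majorant is not symmetric in its variables and `w` need not be even. Exchanging the
variables reflects the weight, which is harmless because the reflection is again an `A_p` weight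
with the same constant. -/
lemma lintegral_swap_eq_weightedEnergy_neg (hw : Measurable w) {Φ : E → E → ℝ≥0∞}
    (hΦ : Measurable (Function.uncurry Φ)) :
    ∫⁻ x, ∫⁻ y, Φ y x ^ p * w (x - y) = weightedEnergy p (fun z => w (-z)) Φ := by
  have hm : Measurable (Function.uncurry fun x y : E => Φ y x ^ p * w (x - y)) :=
    measurable_energy_integrand hw (F := fun x y => Φ y x) (hΦ.comp measurable_swap)
  rw [lintegral_lintegral_swap hm.aemeasurable, weightedEnergy]
  simp

lemma lintegral_const_mul_add_swap (hw : Measurable w) {Φ : E → E → ℝ≥0∞}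
    (hΦ : Measurable (Function.uncurry Φ)) {c : ℝ≥0∞} (hc : c ≠ ∞) :
    ∫⁻ x, ∫⁻ y, c * (Φ x y ^ p * w (x - y) + Φ y x ^ p * w (x - y)) =
      c * (weightedEnergy p w Φ + weightedEnergy p (fun z => w (-z)) Φ) := by
  have hm := measurable_energy_integrand (p := p) hw hΦ
  rw [← lintegral_swap_eq_weightedEnergy_neg hw hΦ, weightedEnergy,
    ← lintegral_add_left (Measurable.lintegral_prod_right
      (f := fun x y => Φ x y ^ p * w (x - y)) hm), ← lintegral_const_mul' _ _ hc]
  refine lintegral_congr fun x => ?_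
  rw [← lintegral_add_left (f := fun y => Φ x y ^ p * w (x - y))
    (hm.comp measurable_prodMk_left), ← lintegral_const_mul' _ _ hc]

lemma weightedEnergy_neg_of_symm (hw : Measurable w) {S : E → E → ℝ≥0∞}
    (hS : Measurable (Function.uncurry S)) (hsymm : ∀ x y, S x y = S y x) :
    weightedEnergy p (fun z => w (-z)) S = weightedEnergy p w S := by
  rw [← lintegral_swap_eq_weightedEnergy_neg hw hS, weightedEnergy]
  exact lintegral_congr fun x => lintegral_congr fun y => by rw [hsymm]

lemma diffQuot_comm {F : Type*} [NormedAddCommGroup F] (G : Set E) (s : ℝ) (f : E → F) (x y : E) :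
    diffQuot G s f x y = diffQuot G s f y x := by
  by_cases h : (x, y) ∈ G ×ˢ G
  · rw [diffQuot, diffQuot, indicator_of_mem h, indicator_of_mem (mk_mem_prod h.2 h.1)]
    rw [← enorm_neg, neg_sub, norm_sub_rev]
  · rw [diffQuot, diffQuot, indicator_of_notMem h,
      indicator_of_notMem (fun h' => h (mk_mem_prod h'.2 h'.1))]

end Energy

/-! ### From `A_p` over cubes to `A_p` over balls. -/

section Weight

variable {n : ℕ} {p : ℝ} {ω : EuclideanSpace ℝ (Fin n) → ℝ}

lemma ball_subset_cube (c : EuclideanSpace ℝ (Fin n)) (r : ℝ) : ball c r ⊆ cube c r := by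
  intro y hy i
  have h := PiLp.norm_apply_le (y - c) i
  rw [mem_ball, dist_eq_norm] at hy
  simpa using h.trans hy.le

lemma cube_subset_ball (c : EuclideanSpace ℝ (Fin n)) {r : ℝ} (hr : 0 < r) :
    cube c r ⊆ ball c ((n + 1) * r) := by
  intro y hy
  rw [mem_ball, dist_eq_norm, EuclideanSpace.norm_eq, Real.sqrt_lt' (by positivity)]
  have hn : (0 : ℝ) ≤ n := n.cast_nonneg
  calc ∑ i, ‖(y - c) i‖ ^ 2 ≤ ∑ _i : Fin n, r ^ 2 := by
        refine Finset.sum_le_sum fun i _ => ?_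
        exact pow_le_pow_left₀ (norm_nonneg _) (hy i) 2
    _ = n * r ^ 2 := by simp
    _ < ((n + 1) * r) ^ 2 := by nlinarith [sq_nonneg r, pow_pos hr 2]

/-- The passage from cubes to balls in the `A_p` condition. -/
def cubeToBall (n : ℕ) (p A : ℝ) : ℝ≥0∞ :=
  ENNReal.ofReal A * ENNReal.ofReal ((n + 1) ^ n) ^ p

/-- A cube lies between concentric balls of radii `r` and `(n + 1) r`, so only a dimensional factor
is lost. The weight is replaced by a Borel representative. -/
lemma exists_ballAp (hp : 1 < p) (hω : IsWeight ω) {A : ℝ} (hA : ApBound p ω A) :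
    ∃ w : EuclideanSpace ℝ (Fin n) → ℝ≥0∞, BallAp p (cubeToBall n p A) w ∧
      ∀ᵐ x, w x = ENNReal.ofReal (ω x) := by
  have hm : AEStronglyMeasurable ω volume := hω.1.aestronglyMeasurable
  refine ⟨fun x => ENNReal.ofReal (hm.mk ω x), ?_, ?_⟩
  swap
  · filter_upwards [hm.ae_eq_mk] with x hx
    rw [hx]
  have hae : ∀ᵐ x, ENNReal.ofReal (hm.mk ω x) = ENNReal.ofReal (ω x) := by
    filter_upwards [hm.ae_eq_mk] with x hx
    rw [hx]
  refine ⟨hm.stronglyMeasurable_mk.measurable.ennreal_ofReal, ?_, by simp, fun c r => ?_,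
    fun c r hr => ?_⟩
  · filter_upwards [hae, hω.2] with x hx h0
    rw [hx]
    simpa using h0
  · have hint : IntegrableOn ω (ball c r) volume :=
      (hω.1.integrableOn_isCompact (isCompact_closedBall c r)).mono_set ball_subset_closedBall
    rw [lintegral_congr_ae (ae_restrict_of_ae hae)]
    refine ((lintegral_mono fun x => ?_).trans_lt hint.hasFiniteIntegral).ne
    exact Real.ofReal_le_enorm _
  · have hp0 : 0 < p := by linarith
    have hp1 : 0 < p - 1 := by linarith
    have hsub := ball_subset_cube c r
    have hQB : volume (cube c r) ≤
        ENNReal.ofReal ((n + 1) ^ n) * volume (ball c r) := by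
      refine (measure_mono (cube_subset_ball c hr)).trans (le_of_eq ?_)
      rw [volume_ball_mul c r (by positivity), finrank_euclideanSpace_fin]
    have hQ0 : volume (cube c r) ≠ 0 :=
      fun h => volume_ball_ne_zero c hr (measure_mono_null hsub h)
    have hQt : volume (cube c r) ≠ ∞ :=
      (hQB.trans_lt (ENNReal.mul_lt_top ENNReal.ofReal_lt_top measure_ball_lt_top)).ne
    have h := hA c r hr
    rw [setLAverage_eq, setLAverage_eq, ENNReal.div_rpow_of_nonneg _ _ hp1.le, div_eq_mul_inv,
      div_eq_mul_inv, mul_mul_mul_comm, ← ENNReal.mul_inv (Or.inl hQ0) (Or.inl hQt),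
      ← div_eq_mul_inv] at h
    have hQp : volume (cube c r) * volume (cube c r) ^ (p - 1) = volume (cube c r) ^ p := by
      conv_rhs => rw [show p = 1 + (p - 1) by ring, ENNReal.rpow_add _ _ hQ0 hQt, ENNReal.rpow_one]
    rw [hQp, ENNReal.div_le_iff (ENNReal.rpow_pos (pos_iff_ne_zero.2 hQ0) hQt).ne'
      (ENNReal.rpow_ne_top_of_nonneg hp0.le hQt)] at h
    have hae' : ∀ᵐ x, ENNReal.ofReal (hm.mk ω x) ^ (-1 / (p - 1)) =
        ENNReal.ofReal (ω x) ^ (-1 / (p - 1)) := by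
      filter_upwards [hae] with x hx
      rw [hx]
    rw [lintegral_congr_ae (ae_restrict_of_ae hae), lintegral_congr_ae (ae_restrict_of_ae hae')]
    calc (∫⁻ x in ball c r, ENNReal.ofReal (ω x)) *
          (∫⁻ x in ball c r, ENNReal.ofReal (ω x) ^ (-1 / (p - 1))) ^ (p - 1)
        ≤ (∫⁻ x in cube c r, ENNReal.ofReal (ω x)) *
          (∫⁻ x in cube c r, ENNReal.ofReal (ω x) ^ (-1 / (p - 1))) ^ (p - 1) :=
          mul_le_mul' (lintegral_mono_set hsub)
            (ENNReal.rpow_le_rpow (lintegral_mono_set hsub) hp1.le)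
      _ ≤ ENNReal.ofReal A * volume (cube c r) ^ p := h
      _ ≤ ENNReal.ofReal A * (ENNReal.ofReal ((n + 1) ^ n) * volume (ball c r)) ^ p := by gcongr
      _ = _ := by rw [ENNReal.mul_rpow_of_nonneg _ _ hp0.le, cubeToBall, mul_assoc]

/-- Adding `1` avoids showing that the infimum is itself an admissible constant. -/
lemma apBound_apConst_add_one (hω : IsApWeight p ω) : ApBound p ω (apConst p ω + 1) := by
  obtain ⟨A₀, hA₀⟩ := hω.2
  obtain ⟨A, ⟨-, hA⟩, hlt⟩ := exists_lt_of_csInf_lt (s := {A : ℝ | 0 < A ∧ ApBound p ω A})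
    ⟨A₀, hA₀⟩ (lt_add_one (apConst p ω))
  exact fun c r hr => (hA c r hr).trans (ENNReal.ofReal_le_ofReal hlt.le)

end Weight

/-! ### Finiteness almost everywhere and the final estimate. -/

section Main

variable {n : ℕ} {p s : ℝ} {𝕜 : Type*} [RCLike 𝕜] {G : Set (EuclideanSpace ℝ (Fin n))}
  {R : EuclideanSpace ℝ (Fin n) → ℝ} {f g : EuclideanSpace ℝ (Fin n) → 𝕜}

/-- All admissible balls lie in `G`, so `M_R f` is dominated by `|g|` plus a multiple of the maximal
function of `|g|` extended by zero, which is in `L^p`. -/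
lemma ae_maximalFunction_lt_top (hp : 1 < p) (hG : IsOpen G)
    (hR : ∀ x ∈ G, 0 ≤ R x ∧ ENNReal.ofReal (R x) ≤ infEDist x (frontier G))
    (hf : MemLp f (ENNReal.ofReal p) (volume.restrict G)) (hg : StronglyMeasurable g)
    (hfg : ∀ᵐ z, z ∈ G → f z = g z) :
    ∀ᵐ x ∂(volume.restrict G), maximalFunction R f x < ∞ := by
  have hp0 : 0 < p := by linarith
  set h : EuclideanSpace ℝ (Fin n) → ℝ≥0∞ := G.indicator fun z => ‖g z‖ₑ with hh
  have hm : Measurable h := hg.enorm.indicator hG.measurableSet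
  have hfin : ∫⁻ x, h x ^ p < ∞ := by
    have h1 := lintegral_rpow_enorm_lt_top_of_eLpNorm_lt_top (by simpa using hp0)
      ENNReal.ofReal_ne_top hf.2
    rw [ENNReal.toReal_ofReal hp0.le] at h1
    refine lt_of_le_of_lt (le_of_eq ?_) h1
    rw [← lintegral_indicator hG.measurableSet]
    refine lintegral_congr_ae ?_
    filter_upwards [hfg] with z hz
    by_cases hzG : z ∈ G
    · simp [hh, hzG, hz hzG]
    · simp [hh, hzG, hp0]
  have hM := (ballAp_one (E := EuclideanSpace ℝ (Fin n)) (p := p)).lintegral_ballMax_rpow_mul_le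
    hp ENNReal.one_ne_top hm
  simp only [mul_one] at hM
  have hMt : ∫⁻ x, ballMax volume h x ^ p ≠ ∞ :=
    (hM.trans_lt (ENNReal.mul_lt_top (apMaxConst_ne_top hp ENNReal.one_ne_top _).lt_top hfin)).ne
  have hae := ae_lt_top ((measurable_ballMax volume h).pow_const p) hMt
  rw [ae_restrict_iff' hG.measurableSet]
  filter_upwards [hae, hfg] with x hx hfx hxG
  have hxt : ballMax volume h x < ∞ := by
    by_contra hcon
    rw [not_lt, top_le_iff] at hcon
    rw [hcon, ENNReal.top_rpow_of_pos hp0] at hx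
    exact lt_irrefl _ hx
  have hball := ball_subset_of_le_infEDist_frontier hG hxG (hR x hxG).2
  refine lt_of_le_of_lt (b := ‖g x‖ₑ +
    ballConst (Module.finrank ℝ (EuclideanSpace ℝ (Fin n))) * ballMax volume h x)
    (iSup₂_le fun r hr => ?_)
    (ENNReal.add_lt_top.2 ⟨enorm_lt_top, ENNReal.mul_lt_top ENNReal.ofReal_lt_top hxt⟩)
  have hballr : ball x r ⊆ G := (ball_subset_ball hr.2).trans hball
  rw [ballAverage_congr hfg (hfx hxG) hballr]
  rcases eq_or_lt_of_le hr.1 with rfl | hr0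
  · rw [ballAverage, if_pos rfl]
    exact le_self_add
  · rw [ballAverage, if_neg hr0.ne']
    refine le_trans ?_ le_add_self
    refine le_trans (le_of_eq ?_) (laverage_ball_le_ballMax h (x := x) (c := x) hr0
      (by simpa using hr0.le))
    exact setLAverage_congr_fun measurableSet_ball fun z hz => by simp [hh, hballr hz]

lemma enorm_toReal_sub_le {a b c c' : ℝ≥0∞} (ha : a ≠ ∞) (hb : b ≠ ∞) (h : a ≤ b + c)
    (h' : b ≤ a + c') : ‖a.toReal - b.toReal‖ₑ ≤ max c c' := by
  rcases le_total b a with hab | hab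
  · rw [← ENNReal.toReal_sub_of_le hab ha, Real.enorm_toReal (ENNReal.sub_ne_top ha)]
    exact (tsub_le_iff_left.2 h).trans (le_max_left _ _)
  · rw [← enorm_neg, neg_sub, ← ENNReal.toReal_sub_of_le hab hb,
      Real.enorm_toReal (ENNReal.sub_ne_top hb)]
    exact (tsub_le_iff_left.2 h').trans (le_max_right _ _)

/-- The factor `d^s` cancels, leaving `2^s ≤ 4`; this keeps the constant independent of `s`. -/
lemma rpow_mul_div_le {d p s : ℝ} (hd : 0 < d) (hp : 0 ≤ p) (hs : 0 ≤ s) (hs2 : s ≤ 2)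
    (T : ℝ≥0∞) : (ENNReal.ofReal (2 * d) ^ s * T) ^ p / ENNReal.ofReal d ^ (s * p) ≤
      4 ^ p * T ^ p := by
  have hd0 : 0 < ENNReal.ofReal d := by simpa using hd
  refine ENNReal.div_le_of_le_mul ?_
  calc (ENNReal.ofReal (2 * d) ^ s * T) ^ p
      = (2 ^ s * ENNReal.ofReal d ^ s * T) ^ p := by
        rw [ENNReal.ofReal_mul zero_le_two, ENNReal.mul_rpow_of_nonneg _ _ hs,
          ENNReal.ofReal_ofNat]
    _ ≤ (4 * ENNReal.ofReal d ^ s * T) ^ p := by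
        gcongr
        calc (2 : ℝ≥0∞) ^ s ≤ 2 ^ (2 : ℝ) := ENNReal.rpow_le_rpow_of_exponent_le one_le_two hs2
          _ = 4 := by rw [ENNReal.rpow_ofNat]; norm_num
    _ = _ := by
        rw [ENNReal.mul_rpow_of_nonneg _ _ hp, ENNReal.mul_rpow_of_nonneg _ _ hp,
          ← ENNReal.rpow_mul]
        ring

lemma weightedEnergy_diffQuot_le (hp : 0 < p) (hG : MeasurableSet G)
    {ω : EuclideanSpace ℝ (Fin n) → ℝ} {w : EuclideanSpace ℝ (Fin n) → ℝ≥0∞}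
    (hwω : ∀ᵐ x, w x = ENNReal.ofReal (ω x)) (hfg : ∀ᵐ z, z ∈ G → f z = g z) :
    weightedEnergy p w (diffQuot G s g) ≤ seminormPow G s p ω f := by
  have hS : ∀ x ∈ G, ∀ y ∈ G, diffQuot G s g x y ^ p =
      ‖g x - g y‖ₑ ^ p / ENNReal.ofReal ‖x - y‖ ^ (s * p) := by
    intro x hx y hy
    rw [diffQuot, indicator_of_mem (mk_mem_prod hx hy), ENNReal.div_rpow_of_nonneg _ _ hp.le,
      ← ENNReal.rpow_mul]
  have hS0 : ∀ x y, (x, y) ∉ G ×ˢ G → diffQuot G s g x y ^ p = 0 := by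
    intro x y h
    rw [diffQuot, indicator_of_notMem h, ENNReal.zero_rpow_of_pos hp]
  rw [weightedEnergy, seminormPow, ← lintegral_indicator hG]
  refine lintegral_mono_ae ?_
  filter_upwards [hfg] with x hfx
  by_cases hx : x ∈ G
  · rw [indicator_of_mem hx, ← lintegral_indicator hG]
    refine lintegral_mono_ae ?_
    filter_upwards [hfg, (Measure.measurePreserving_sub_left volume x).quasiMeasurePreserving.ae
      hwω] with y hfy hy
    by_cases hyG : y ∈ G
    · rw [indicator_of_mem hyG, hS x hx y hyG, hfx hx, hfy hyG, hy]
    · rw [hS0 x y (fun h => hyG h.2), zero_mul]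
      exact zero_le
  · rw [indicator_of_notMem hx]
    simp [hS0 x _ (fun h => hx h.1)]

theorem modifiedSeminormPow_maximalFunction_le (hp : 1 < p) (hG : IsOpen G) (hs : 0 ≤ s)
    (hs2 : s ≤ 2)
    (hR : ∀ x ∈ G, 0 ≤ R x ∧ ENNReal.ofReal (R x) ≤ infEDist x (frontier G))
    {ω : EuclideanSpace ℝ (Fin n) → ℝ} {A : ℝ≥0∞} (hA : A ≠ ∞)
    {w : EuclideanSpace ℝ (Fin n) → ℝ≥0∞} (hw : BallAp p A w)
    (hwω : ∀ᵐ x, w x = ENNReal.ofReal (ω x)) (hg : StronglyMeasurable g)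
    (hfg : ∀ᵐ z, z ∈ G → f z = g z)
    (hfin : ∀ᵐ x ∂(volume.restrict G), maximalFunction R f x < ∞) :
    modifiedSeminormPow G R s p ω (fun x => (maximalFunction R f x).toReal) ≤
      4 ^ p * (2 * majorantConst n p A) * seminormPow G s p ω f := by
  have hp0 : 0 < p := by linarith
  have h4 : (4 : ℝ≥0∞) ^ p ≠ ∞ := ENNReal.rpow_ne_top_of_nonneg hp0.le (by simp)
  have hS := measurable_diffQuot hG.measurableSet s hg
  set S := diffQuot G s g with hSdef
  have hT := measurable_majorant hS
  set T := majorant S with hTdef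
  have hfgG : ∀ᵐ z ∂(volume.restrict G), f z = g z :=
    (ae_restrict_iff' hG.measurableSet).2 hfg
  have hGG : ∀ᵐ z ∂(volume.restrict G), z ∈ G := ae_restrict_mem hG.measurableSet
  have step1 : modifiedSeminormPow G R s p ω (fun x => (maximalFunction R f x).toReal) ≤
      ∫⁻ x, ∫⁻ y, 4 ^ p * (T x y ^ p * w (x - y) + T y x ^ p * w (x - y)) := by
    unfold modifiedSeminormPow
    refine le_trans (lintegral_mono_ae ?_) (setLIntegral_le_lintegral G _)
    filter_upwards [hfgG, hGG, hfin] with x hfx hx hMx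
    refine le_trans (lintegral_mono_ae ?_) (setLIntegral_le_lintegral G _)
    filter_upwards [hfgG, hGG, hfin, ae_restrict_of_ae
      ((Measure.measurePreserving_sub_left volume x).quasiMeasurePreserving.ae hwω)]
      with y hfy hy hMy hwy
    rcases eq_or_ne x y with rfl | hxy
    · simp [hp0]
    have hd0 : 0 < ‖x - y‖ + |R x - R y| :=
      add_pos_of_pos_of_nonneg (norm_pos_iff.2 (sub_ne_zero.2 hxy)) (abs_nonneg _)
    have k1 := maximalFunction_le_add_majorant hG hs hR hg hfg hx hy hfx hfy hxy
    have k2 := maximalFunction_le_add_majorant hG hs hR hg hfg hy hx hfy hfx hxy.symm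
    rw [norm_sub_rev, abs_sub_comm] at k2
    rw [← hwy, ← add_mul, ← mul_assoc]
    gcongr
    calc ‖(maximalFunction R f x).toReal - (maximalFunction R f y).toReal‖ₑ ^ p /
          ENNReal.ofReal (‖x - y‖ + |R x - R y|) ^ (s * p)
        ≤ (max (ENNReal.ofReal (2 * (‖x - y‖ + |R x - R y|)) ^ s * T x y)
            (ENNReal.ofReal (2 * (‖x - y‖ + |R x - R y|)) ^ s * T y x)) ^ p /
          ENNReal.ofReal (‖x - y‖ + |R x - R y|) ^ (s * p) := by
          gcongr
          exact enorm_toReal_sub_le hMx.ne hMy.ne k1 k2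
      _ ≤ 4 ^ p * T x y ^ p + 4 ^ p * T y x ^ p := by
          -- The two one-sided bounds give a maximum of `T x y` and `T y x`; it is replaced by a
          -- sum, so that each energy can be estimated separately.
          rcases max_choice (ENNReal.ofReal (2 * (‖x - y‖ + |R x - R y|)) ^ s * T x y)
            (ENNReal.ofReal (2 * (‖x - y‖ + |R x - R y|)) ^ s * T y x) with h | h
          · rw [h]
            exact (rpow_mul_div_le hd0 hp0.le hs hs2 _).trans le_self_add
          · rw [h]
            exact (rpow_mul_div_le hd0 hp0.le hs hs2 _).trans le_add_self
      _ = _ := by ring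
  have step2 := lintegral_const_mul_add_swap (p := p) hw.measurable hT h4
  have e1 := weightedEnergy_majorant_le hw hp hA hS
  have e2 := weightedEnergy_majorant_le hw.comp_neg hp hA hS
  -- The difference quotient is symmetric, so reflecting the weight does not change its energy.
  rw [weightedEnergy_neg_of_symm (p := p) hw.measurable hS (diffQuot_comm G s g)] at e2
  rw [finrank_euclideanSpace_fin] at e1 e2
  have e3 : weightedEnergy p w S ≤ seminormPow G s p ω f :=
    weightedEnergy_diffQuot_le hp0 hG.measurableSet hwω hfg
  calc modifiedSeminormPow G R s p ω (fun x => (maximalFunction R f x).toReal)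
      ≤ 4 ^ p * (weightedEnergy p w T + weightedEnergy p (fun z => w (-z)) T) :=
        step1.trans_eq step2
    _ ≤ 4 ^ p * (majorantConst n p A * weightedEnergy p w S +
          majorantConst n p A * weightedEnergy p w S) := by gcongr
    _ = 4 ^ p * (2 * majorantConst n p A) * weightedEnergy p w S := by ring
    _ ≤ _ := by gcongr

end Main

end FracMaximal

end

/-- The constant is `C [ω]_{A_p}` with a function `C` that is fixed once `n` and `p` are given. The
distance to the boundary is the extended one, so it is infinite when `∂G` is empty. -/
theorem theorem4p1 (n : ℕ) (p : ℝ) (hp : 1 < p) :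
    ∃ C : ℝ → ℝ, (∀ t, 0 < C t) ∧
      ∀ (G : Set (EuclideanSpace ℝ (Fin n))), IsOpen G → G.Nonempty →
      ∀ (s : ℝ), 0 ≤ s → s ≤ 2 →
      ∀ (R : EuclideanSpace ℝ (Fin n) → ℝ), Measurable (fun x : G => R x) →
        (∀ x ∈ G, 0 ≤ R x ∧ ENNReal.ofReal (R x) ≤ Metric.infEDist x (frontier G)) →
      ∀ (ω : EuclideanSpace ℝ (Fin n) → ℝ), FracMaximal.IsApWeight p ω →
      ∀ (𝕜 : Type) [RCLike 𝕜] (f : EuclideanSpace ℝ (Fin n) → 𝕜),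
        MemLp f (ENNReal.ofReal p) (volume.restrict G) →
        (∀ᵐ x ∂(volume.restrict G), FracMaximal.maximalFunction R f x < ∞) ∧
        FracMaximal.modifiedSeminormPow G R s p ω
            (fun x => (FracMaximal.maximalFunction R f x).toReal)
          ≤ ENNReal.ofReal (C (FracMaximal.apConst p ω)) *
              FracMaximal.seminormPow G s p ω f := by
  have hp0 : 0 < p := by linarith
  let K : ℝ → ℝ≥0∞ := fun t =>
    4 ^ p * (2 * FracMaximal.majorantConst n p (FracMaximal.cubeToBall n p (t + 1)))
  have hA : ∀ t, FracMaximal.cubeToBall n p t ≠ ∞ := fun t =>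
    ENNReal.mul_ne_top ENNReal.ofReal_ne_top
      (ENNReal.rpow_ne_top_of_nonneg hp0.le ENNReal.ofReal_ne_top)
  have hK : ∀ t, K t ≠ ∞ := fun t =>
    ENNReal.mul_ne_top (ENNReal.rpow_ne_top_of_nonneg hp0.le (by simp))
      (ENNReal.mul_ne_top (by simp) (FracMaximal.majorantConst_ne_top hp (hA _) n))
  -- The added `1` makes the constant positive for every `t`.
  refine ⟨fun t => (K t).toReal + 1, fun t => by positivity, ?_⟩
  intro G hG _ s hs hs2 R _ hR ω hω 𝕜 _ f hf
  have hm := hf.1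
  have hg := hm.stronglyMeasurable_mk
  have hfg : ∀ᵐ z, z ∈ G → f z = hm.mk f z :=
    (ae_restrict_iff' hG.measurableSet).1 hm.ae_eq_mk
  have hfin := FracMaximal.ae_maximalFunction_lt_top hp hG hR hf hg hfg
  refine ⟨hfin, ?_⟩
  obtain ⟨w, hw, hwω⟩ := FracMaximal.exists_ballAp hp hω.1 (FracMaximal.apBound_apConst_add_one hω)
  refine (FracMaximal.modifiedSeminormPow_maximalFunction_le hp hG hs hs2 hR (hA _) hw hwω hg hfg
    hfin).trans ?_
  gcongr
  calc K (FracMaximal.apConst p ω) = ENNReal.ofReal (K (FracMaximal.apConst p ω)).toReal :=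
        (ENNReal.ofReal_toReal (hK _)).symm
    _ ≤ _ := ENNReal.ofReal_le_ofReal (by simp)
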